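/- Let $\xi(s)=\tfrac12 s(s-1)\pi^{-s/2}\Gamma(s/2)\zeta(s)$ be the Riemann $\xi$-function, extended to an entire function. For real $h$ put $$A_h(s)=\tfrac12\bigl(\xi(s+h)+\xi(s-h)\bigr),\qquad B_h(s)=-\tfrac1{2i}\bigl(\xi(s+h)-\xi(s-h)\bigr),$$ and for real $\theta$ put $$A_{h,\theta}(s)=(\cos\theta)A_h(s)+(\sin\theta)B_h(s),\qquad B_{h,\theta}(s)=-(\sin\theta)A_h(s)+(\cos\theta)B_h(s),$$ so that $e^{i\theta}\xi(s+h)=A_{h,\theta}(s)-iB_{h,\theta}(s)$. **Theorem 2.1.** (1) For real $h$ with $|h|\ge\tfrac12$ and any $0\le\theta<2\pi$, the entire functions $A_{h,\theta}(s)$ and $B_{h,\theta}(s)$ have all their zeros on the critical line $\Re(s)=\tfrac12$. These zeros are all simple zeros, and they interlace. (2) Assuming the Riemann hypothesis, for real $h$ with $0<|h|<\tfrac12$ and any $0\le\theta<2\pi$ the functions $A_{h,\theta}(s)$ and $B_{h,\theta}(s)$ have all their zeros on the critical line $\Re(s)=\tfrac12$. These zeros are all simple zeros, and they interlace. Here the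 zeros of two entire functions $A$ and $B$, all lying on the critical line, are said to *interlace* if they can be numbered, counting multiplicity and with imaginary parts in non-decreasing order, as $\{\tfrac12+i\gamma_n(A):n\in\mathbb Z\}$ and $\{\tfrac12+i\gamma_n(B):n\in\mathbb Z\}$ so that $\gamma_n(A)\le\gamma_n(B)\le\gamma_{n+1}(A)$ for all $n\in\mathbb Z$. -/

import Mathlib

namespace XiShift

open Complex

/-- The Riemann `ξ`-function as an entire function. In terms of the completed zeta function
`Λ(s) = π ^ (-s / 2) Γ(s / 2) ζ(s) = Λ₀(s) - 1 / s - 1 / (1 - s)`, one has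
`ξ(s) = s (s - 1) Λ(s) / 2 = (s (s - 1) Λ₀(s) + 1) / 2`; the last expression also has the right
values at the removable singularities of the classical formula. -/
noncomputable def xi (s : ℂ) : ℂ :=
  (s * (s - 1) * completedRiemannZeta₀ s + 1) / 2

/-- The function `xi` is given by the classical formula wherever all factors of the latter are
finite. -/
theorem xi_eq (s : ℂ) (h0 : ∀ n : ℕ, s ≠ -(2 * n)) (h1 : s ≠ 1) :
    xi s = 1 / 2 * s * (s - 1) * (Real.pi : ℂ) ^ (-s / 2) * Gamma (s / 2) * riemannZeta s := by
  have hs : s ≠ 0 := by simpa using h0 0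
  have hG : Gammaℝ s ≠ 0 := by
    rw [Ne, Gammaℝ_eq_zero_iff]
    rintro ⟨n, hn⟩
    exact h0 n hn
  have h1' : 1 - s ≠ 0 := sub_ne_zero.mpr h1.symm
  have key : Gammaℝ s * riemannZeta s = completedRiemannZeta₀ s - 1 / s - 1 / (1 - s) := by
    rw [riemannZeta_def_of_ne_zero hs, completedRiemannZeta_eq]
    field_simp
  calc xi s = 1 / 2 * s * (s - 1) * (completedRiemannZeta₀ s - 1 / s - 1 / (1 - s)) := by
        unfold xi
        field_simp
        ring
    _ = _ := by
        rw [← key, Gammaℝ_def]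
        ring

theorem differentiable_xi : Differentiable ℂ xi := by
  have := differentiable_completedZeta₀
  unfold xi
  fun_prop

/-- `A_h(s) = (ξ(s + h) + ξ(s - h)) / 2`. -/
noncomputable def A (h : ℝ) (s : ℂ) : ℂ :=
  1 / 2 * (xi (s + h) + xi (s - h))

/-- `B_h(s) = -(ξ(s + h) - ξ(s - h)) / (2 i)`. -/
noncomputable def B (h : ℝ) (s : ℂ) : ℂ :=
  -(1 / (2 * I)) * (xi (s + h) - xi (s - h))

/-- `A_{h,θ} = cos θ · A_h + sin θ · B_h`. -/
noncomputable def Arot (h θ : ℝ) (s : ℂ) : ℂ :=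
  (Real.cos θ : ℂ) * A h s + (Real.sin θ : ℂ) * B h s

/-- `B_{h,θ} = -sin θ · A_h + cos θ · B_h`. -/
noncomputable def Brot (h θ : ℝ) (s : ℂ) : ℂ :=
  -(Real.sin θ : ℂ) * A h s + (Real.cos θ : ℂ) * B h s

/-- The functions `A_{h,θ}` and `B_{h,θ}` are entire. -/
theorem differentiable_Arot_Brot (h θ : ℝ) :
    Differentiable ℂ (Arot h θ) ∧ Differentiable ℂ (Brot h θ) := by
  have := differentiable_xi
  unfold Arot Brot A B
  constructor <;> fun_prop

/-- `A_{h,θ} - i B_{h,θ}` is the rotated and shifted function `e^{iθ} ξ(s + h)`. -/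
theorem Arot_sub_Brot (h θ : ℝ) (s : ℂ) :
    Arot h θ s - I * Brot h θ s = exp (I * θ) * xi (s + h) := by
  have hI : I * I = -1 := I_mul_I
  have hB : B h s = I / 2 * (xi (s + h) - xi (s - h)) := by
    have : -(1 / (2 * I)) = I / 2 := by
      field_simp
      simp
    rw [B, this]
  rw [mul_comm I (θ : ℂ), exp_mul_I, Arot, Brot, hB, A]
  push_cast
  linear_combination (-(1 / 2) * cos (θ : ℂ) * (xi (s + h) - xi (s - h))) * hI

/-- All zeros of `f` lie on the critical line. -/
def ZerosOnCriticalLine (f : ℂ → ℂ) : Prop :=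
  ∀ s : ℂ, f s = 0 → s.re = 1 / 2

/-- All zeros of the entire function `f` are simple. -/
def ZerosSimple (f : ℂ → ℂ) : Prop :=
  ∀ s : ℂ, f s = 0 → analyticOrderAt f s = 1

/-- `γ` numbers the zeros `1/2 + i γ n` (`n ∈ ℤ`) of the entire function `f`, all of which lie on
the critical line, by increasing imaginary part and counted with multiplicity: each point `s` is
listed as often as its multiplicity as a zero of `f` (which is `0` if `f s ≠ 0`). -/
def IsZeroNumbering (f : ℂ → ℂ) (γ : ℤ → ℝ) : Prop :=
  Monotone γ ∧ ∀ s : ℂ, {n : ℤ | (1 / 2 : ℂ) + I * (γ n : ℂ) = s}.encard = analyticOrderAt f s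

/-- The zeros of `f` and `g` interlace on the critical line. -/
def ZerosInterlace (f g : ℂ → ℂ) : Prop :=
  ∃ α β : ℤ → ℝ, IsZeroNumbering f α ∧ IsZeroNumbering g β ∧
    ∀ n : ℤ, α n ≤ β n ∧ β n ≤ α (n + 1)

end XiShift

namespace XiShift

open Complex

/-! ### Symmetries of `ξ` -/

/-! For `h > 0`, `A_{h,θ}` is half the sum of `e^{iθ} ξ(s + h)` and `e^{-iθ} ξ(s - h)`, and `B_{h,θ}
= A_{h,θ+π/2}`, so one family has to be understood; `h < 0` reduces to `-h` with `θ` negated.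

The quotient `ξ(s - h) / ξ(s + h)` has modulus one on the critical line, by `ξ(1 - conj s) = conj
ξ(s)`. If `ξ(s + h)` has no zeros for `Re s ≥ 1/2` (unconditional for `h ≥ 1/2`, RH otherwise),
Phragmén–Lindelöf bounds it by one there and the maximum principle makes the bound strict off the
line (`IsDominatingShift.norm_lt`). A zero of `A_{h,θ}` makes both moduli equal, so it lies on the
line.

On the line write `ξ(1/2 + h + it) = ρ e^{iφ}`; then `A_{h,θ} = ρ cos(φ + θ)`. The derivative `φ' =
Re (ξ'/ξ)` is positive by a Hopf-type boundary argument for the quotient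
(`IsDominatingShift.re_logDeriv_pos`), which gives simplicity. A bounded `φ` would leave every
`A_{h,θ}` with finitely many zeros; being of order less than two they would be of exponential type,
hence so would `ξ`, which grows too fast on the real axis. As `φ(t) + φ(-t)` is constant, `φ` is an
increasing bijection of the real line. The zeros of the two functions correspond to two progressions
of step `π` offset by `π/2`, and these interlace. -/

theorem xi_one_sub (s : ℂ) : xi (1 - s) = xi s := by
  unfold xi
  rw [completedRiemannZeta₀_one_sub]
  ring

theorem completedRiemannZeta₀_eq_mellin (s : ℂ) :
    completedRiemannZeta₀ s = mellin (HurwitzZeta.hurwitzEvenFEPair 0).f_modif (s / 2) / 2 := rfl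

theorem f_modif_conj (t : ℝ) :
    (starRingEnd ℂ) ((HurwitzZeta.hurwitzEvenFEPair 0).f_modif t) =
      (HurwitzZeta.hurwitzEvenFEPair 0).f_modif t := by
  simp only [WeakFEPair.f_modif, HurwitzZeta.hurwitzEvenFEPair, Pi.add_apply, map_add,
    Set.indicator_apply, apply_ite (starRingEnd ℂ)]
  simp

/-- `Λ₀` is the Mellin transform of a real kernel, so conjugation passes under the integral. -/
theorem completedRiemannZeta₀_conj (s : ℂ) :
    completedRiemannZeta₀ ((starRingEnd ℂ) s) = (starRingEnd ℂ) (completedRiemannZeta₀ s) := by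
  rw [completedRiemannZeta₀_eq_mellin, completedRiemannZeta₀_eq_mellin, map_div₀, mellin, mellin,
    ← integral_conj, map_ofNat]
  congr 1
  refine MeasureTheory.setIntegral_congr_fun measurableSet_Ioi fun t (ht : 0 < t) ↦ ?_
  simp only [smul_eq_mul, map_mul, f_modif_conj]
  have h1 : (starRingEnd ℂ) s / 2 - 1 = (starRingEnd ℂ) (s / 2 - 1) := by simp [map_ofNat]
  rw [h1, cpow_conj _ _ (by rw [arg_ofReal_of_nonneg ht.le]; exact Real.pi_pos.ne), conj_ofReal]

theorem xi_conj (s : ℂ) : xi ((starRingEnd ℂ) s) = (starRingEnd ℂ) (xi s) := by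
  unfold xi
  rw [completedRiemannZeta₀_conj]
  simp [map_ofNat]

/-! ### The zeta function to the right of the critical strip -/

theorem norm_riemannZeta_sub_one_le {s : ℂ} (hs : 2 ≤ s.re) :
    ‖riemannZeta s - 1‖ ≤ 2 / 3 := by
  have h1 : HasSum (fun n : ℕ ↦ (1 : ℝ) / (n + 1 + 1 : ℝ) ^ 2) (Real.pi ^ 2 / 6 - 1) := by
    have := (hasSum_nat_add_iff' 2).mpr hasSum_zeta_two
    simpa [Finset.sum_range_succ, add_assoc, one_add_one_eq_two] using this
  have hsum : Summable (fun n : ℕ ↦ 1 / (n + 1 : ℂ) ^ s) := by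
    have := (summable_nat_add_iff 1).mpr (Complex.summable_one_div_nat_cpow.mpr
      (lt_of_lt_of_le one_lt_two hs))
    simpa using this
  rw [zeta_eq_tsum_one_div_nat_add_one_cpow (lt_of_lt_of_le one_lt_two hs),
    hsum.tsum_eq_zero_add]
  have h2 : ∀ n : ℕ, ‖1 / (((n + 1 : ℕ) : ℂ) + 1) ^ s‖ ≤ 1 / (n + 1 + 1 : ℝ) ^ 2 := by
    intro n
    have : (((n + 1 : ℕ) : ℂ) + 1) = ((n + 1 + 1 : ℝ) : ℂ) := by push_cast; ring
    rw [this, norm_div, norm_cpow_eq_rpow_re_of_pos (by positivity), norm_one]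
    gcongr
    rw [← Real.rpow_natCast]
    exact Real.rpow_le_rpow_of_exponent_le (by linarith [n.cast_nonneg (α := ℝ)]) (by simpa using hs)
  have h3 := tsum_of_norm_bounded h1 h2
  have : Real.pi ^ 2 / 6 - 1 ≤ 2 / 3 := by
    nlinarith [Real.pi_lt_d2, Real.pi_pos]
  simpa using h3.trans this

theorem norm_riemannZeta_le {s : ℂ} (hs : 2 ≤ s.re) : ‖riemannZeta s‖ ≤ 2 := by
  have := norm_le_norm_sub_add (riemannZeta s) 1
  rw [norm_one] at this
  linarith [norm_riemannZeta_sub_one_le hs]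

theorem le_norm_riemannZeta {s : ℂ} (hs : 2 ≤ s.re) : 1 / 3 ≤ ‖riemannZeta s‖ := by
  have := norm_sub_norm_le (1 : ℂ) (1 - riemannZeta s)
  rw [norm_one, sub_sub_cancel, norm_sub_rev] at this
  linarith [norm_riemannZeta_sub_one_le hs]

/-! ### Bounds for the Gamma function -/

theorem norm_Gamma_le {s : ℂ} (hs : 0 < s.re) : ‖Gamma s‖ ≤ Real.Gamma s.re := by
  rw [Gamma_eq_integral hs, GammaIntegral, Real.Gamma_eq_integral hs]
  refine (MeasureTheory.norm_integral_le_integral_norm _).trans_eq ?_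
  refine MeasureTheory.setIntegral_congr_fun measurableSet_Ioi fun t (ht : 0 < t) ↦ ?_
  simp only [norm_mul]
  rw [norm_cpow_eq_rpow_re_of_pos ht, Complex.norm_of_nonneg (Real.exp_pos _).le]
  simp

/-- The exponent `3/2` used for all growth bounds leaves room above 1 for the factor `log n` in `n!
≤ n ^ n = exp (n log n)`, and stays below the order 2 that Phragmén–Lindelöf requires. -/
theorem realGamma_le {x : ℝ} (hx : 2 ≤ x) :
    Real.Gamma x ≤ Real.exp (2 * (1 + x) ^ (3 / 2 : ℝ)) := by
  set n := ⌈x⌉₊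
  have hn : x ≤ n := Nat.le_ceil x
  have hn' : (n : ℝ) ≤ x + 1 := (Nat.ceil_lt_add_one (by linarith)).le
  have hn0 : (0 : ℝ) < n := by linarith
  calc Real.Gamma x ≤ Real.Gamma (n + 1) :=
        Real.Gamma_strictMonoOn_Ici.monotoneOn (by exact hx)
          (Set.mem_Ici.mpr (by linarith)) (by linarith)
    _ = n.factorial := Real.Gamma_nat_eq_factorial n
    _ ≤ (n : ℝ) ^ n := by exact_mod_cast n.factorial_le_pow
    _ = Real.exp (n * Real.log n) := by
        rw [Real.exp_nat_mul, Real.exp_log hn0]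
    _ ≤ _ := by
        refine Real.exp_le_exp.mpr ?_
        calc n * Real.log n ≤ n * ((n : ℝ) ^ (1 / 2 : ℝ) / (1 / 2)) := by
              gcongr
              exact Real.log_le_rpow_div hn0.le (by norm_num)
          _ = 2 * (n : ℝ) ^ (3 / 2 : ℝ) := by
              rw [show (3 / 2 : ℝ) = 1 + 1 / 2 by norm_num, Real.rpow_add hn0, Real.rpow_one]
              ring
          _ ≤ 2 * (1 + x) ^ (3 / 2 : ℝ) := by
              gcongr
              linarith

/-- The factor `‖z‖` is kept so that it cancels the numerator `πw` in the reflection formula. -/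
theorem norm_sin_le (z : ℂ) : ‖sin z‖ ≤ ‖z‖ * Real.exp (3 * ‖z‖) := by
  have h1 : sin z = exp (-z * I) * (1 - exp (2 * z * I)) * I / 2 := by
    rw [sin, mul_sub, ← exp_add]
    ring_nf
  have h2 : ‖1 - exp (2 * z * I)‖ ≤ 2 * ‖z‖ * Real.exp (2 * ‖z‖) := by
    have := norm_exp_sub_sum_le_norm_mul_exp (2 * z * I) 1
    simpa [norm_sub_rev] using this
  have h3 : ‖exp (-z * I)‖ ≤ Real.exp ‖z‖ := by
    simpa using norm_exp_le_exp_norm (-z * I)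
  rw [h1, norm_div, norm_mul, norm_mul, norm_I, RCLike.norm_ofNat]
  calc _ ≤ Real.exp ‖z‖ * (2 * ‖z‖ * Real.exp (2 * ‖z‖)) * 1 / 2 := by gcongr
    _ = _ := by
      rw [show 3 * ‖z‖ = ‖z‖ + 2 * ‖z‖ by ring, Real.exp_add]
      ring

/-- The reflection formula `Γ(1 + w) Γ(1 - w) sin(πw) = πw` turns upper bounds for `Γ(1 - w)` and
the sine into a lower bound for `Γ(1 + w)`. -/
theorem exists_le_norm_Gamma_strip :
    ∃ c : ℝ, 0 < c ∧ ∀ s : ℂ, 1 / 2 ≤ s.re → s.re ≤ 3 / 2 →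
      c * Real.exp (-(3 * Real.pi) * |s.im|) ≤ ‖Gamma s‖ := by
  obtain ⟨M, hM⟩ := (isCompact_Icc (a := (1 / 2 : ℝ)) (b := 3 / 2)).exists_bound_of_continuousOn
    (f := Real.Gamma) (fun x hx ↦ (Real.differentiableAt_Gamma fun m ↦ by
      have := hx.1
      have := m.cast_nonneg (α := ℝ)
      linarith).continuousAt.continuousWithinAt)
  have hM0 : 0 < M := by
    have := hM 1 (by norm_num)
    simp at this
    linarith
  refine ⟨M⁻¹ * Real.exp (-(3 * Real.pi / 2)), by positivity, fun s h1 h2 ↦ ?_⟩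
  obtain ⟨w, rfl⟩ : ∃ w, s = 1 + w := ⟨s - 1, by ring⟩
  simp only [add_re, one_re, add_im, one_im, zero_add] at *
  have hwn : ‖w‖ ≤ 1 / 2 + |w.im| := by
    refine (norm_le_abs_re_add_abs_im w).trans ?_
    gcongr
    rw [abs_le]
    constructor <;> linarith
  have hG : ‖Gamma (1 - w)‖ ≤ M := by
    refine (norm_Gamma_le (by simp; linarith)).trans ((le_abs_self _).trans (hM _ ?_))
    simp
    constructor <;> linarith
  have key : Real.exp (-(3 * (Real.pi * ‖w‖))) ≤ ‖Gamma (1 + w)‖ * M := by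
    rcases eq_or_ne w 0 with rfl | hw
    · simp at hG
      simpa using hG
    have e1 : Gamma (1 + w) * Gamma (1 - w) * sin (Real.pi * w) = Real.pi * w := by
      have hsin : sin (Real.pi * w) ≠ 0 := by
        rw [Ne, sin_eq_zero_iff]
        rintro ⟨k, hk⟩
        have hk' : w = k := by
          have : (Real.pi : ℂ) ≠ 0 := by exact_mod_cast Real.pi_ne_zero
          apply mul_left_cancel₀ this
          rw [hk]; ring
        subst hk'
        have hk1 : (-1 : ℝ) < k := by simp at h1; linarith
        have hk2 : (k : ℝ) < 1 := by simp at h2; linarith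
        have : k = 0 := by
          have : -1 < k := by exact_mod_cast hk1
          have : k < 1 := by exact_mod_cast hk2
          omega
        simp [this] at hw
      rw [add_comm, Gamma_add_one w hw, mul_assoc w, Gamma_mul_Gamma_one_sub, mul_assoc,
        div_mul_cancel₀ _ hsin, mul_comm]
    have e2 : Real.pi * ‖w‖ ≤ ‖Gamma (1 + w)‖ * M *
        (Real.pi * ‖w‖ * Real.exp (3 * (Real.pi * ‖w‖))) := by
      have hn : ‖(Real.pi : ℂ) * w‖ = Real.pi * ‖w‖ := by
        rw [norm_mul, Complex.norm_of_nonneg Real.pi_pos.le]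
      calc Real.pi * ‖w‖ = ‖Gamma (1 + w) * Gamma (1 - w) * sin (Real.pi * w)‖ := by
            rw [e1, hn]
        _ ≤ _ := by
          rw [norm_mul, norm_mul, ← hn]
          gcongr
          exact norm_sin_le _
    have hw' : 0 < Real.pi * ‖w‖ := mul_pos Real.pi_pos (norm_pos_iff.mpr hw)
    rw [Real.exp_neg, inv_le_iff_one_le_mul₀ (Real.exp_pos _)]
    refine le_of_mul_le_mul_left ?_ hw'
    linarith
  calc _ = M⁻¹ * Real.exp (-(3 * (Real.pi * (1 / 2 + |w.im|)))) := by
        rw [mul_assoc, ← Real.exp_add]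
        ring_nf
    _ ≤ M⁻¹ * Real.exp (-(3 * (Real.pi * ‖w‖))) := by gcongr
    _ ≤ M⁻¹ * (‖Gamma (1 + w)‖ * M) := by gcongr
    _ = _ := by field_simp

theorem exists_exp_le_norm_Gamma :
    ∃ C : ℝ, 0 ≤ C ∧ ∀ s : ℂ, 1 / 2 ≤ s.re → Real.exp (-C * (1 + ‖s‖)) ≤ ‖Gamma s‖ := by
  obtain ⟨c, hc, h⟩ := exists_le_norm_Gamma_strip
  -- Induct with `Γ(s) = (s - 1) Γ(s - 1)`: each unit step costs at most a factor `e⁻¹ ≤ 1/2 ≤ |s -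
  -- 1|`, paid for by `-s.re` in the exponent.
  have step : ∀ n : ℕ, ∀ s : ℂ, 1 / 2 ≤ s.re → s.re ≤ n + 3 / 2 →
      c * Real.exp (-s.re - (3 * Real.pi) * |s.im|) ≤ ‖Gamma s‖ := by
    intro n
    induction n with
    | zero =>
      intro s h1 h2
      refine le_trans ?_ (h s h1 (by simpa using h2))
      gcongr
      linarith
    | succ n ih =>
      intro s h1 h2
      by_cases h3 : s.re ≤ 3 / 2
      · refine le_trans ?_ (h s h1 h3)
        gcongr
        linarith
      push Not at h3
      have h4 := ih (s - 1) (by simp; linarith) (by push_cast at h2; simp; linarith)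
      have h5 : Gamma s = (s - 1) * Gamma (s - 1) := by
        have : s - 1 ≠ 0 := fun h0 ↦ by
          have := congrArg re h0
          simp at this
          linarith
        rw [← Gamma_add_one _ this, sub_add_cancel]
      have h6 : Real.exp (-1) ≤ ‖s - 1‖ := by
        have : (s - 1).re ≤ ‖s - 1‖ := re_le_norm _
        have h7 : Real.exp (-1) ≤ 1 / 2 := by
          rw [Real.exp_neg, one_div]
          gcongr
          linarith [Real.add_one_le_exp 1]
        simp at this
        linarith
      rw [h5, norm_mul]
      calc _ = Real.exp (-1) * (c * Real.exp (-(s - 1).re - (3 * Real.pi) * |(s - 1).im|)) := by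
            rw [mul_left_comm, ← Real.exp_add]
            simp only [sub_re, sub_im, one_re, one_im, sub_zero]
            ring_nf
        _ ≤ _ := by gcongr
  refine ⟨3 * Real.pi + 1 + |Real.log c|, by positivity, fun s hs ↦ ?_⟩
  obtain ⟨n, hn⟩ := exists_nat_ge s.re
  refine le_trans ?_ (step n s hs (by linarith))
  rw [← Real.exp_log hc, ← Real.exp_add, Real.log_exp]
  gcongr
  have h1 := abs_re_le_norm s
  have h2 := abs_im_le_norm s
  have h3 := le_abs_self s.re
  have h4 := neg_abs_le (Real.log c)
  have h5 : 0 ≤ |Real.log c| * ‖s‖ := by positivity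
  have h6 : 3 * Real.pi * |s.im| ≤ 3 * Real.pi * ‖s‖ := by gcongr
  nlinarith [Real.pi_pos, norm_nonneg s]

/-! ### Growth of `ξ` -/

theorem norm_xi {s : ℂ} (hs : 0 < s.re) (h1 : s ≠ 1) :
    ‖xi s‖ = 1 / 2 * ‖s‖ * ‖s - 1‖ * Real.pi ^ (-s.re / 2) * ‖Gamma (s / 2)‖ *
      ‖riemannZeta s‖ := by
  rw [xi_eq s (fun n hn ↦ ?_) h1]
  · simp only [norm_mul]
    rw [norm_cpow_eq_rpow_re_of_pos Real.pi_pos]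
    congr 5
    · simp
    · simp
  · have := congrArg re hn
    simp at this
    linarith [n.cast_nonneg (α := ℝ)]

theorem xi_ne_zero_of_riemannZeta_ne_zero {s : ℂ} (hs : 0 < s.re) (h : riemannZeta s ≠ 0) :
    xi s ≠ 0 := by
  rcases eq_or_ne s 1 with rfl | h1
  · simp [xi]
  rw [← norm_ne_zero_iff, norm_xi hs h1]
  have h2 : 0 < (s / 2).re := by simpa using hs
  have h0 : s ≠ 0 := fun h ↦ by simp [h] at hs
  have := Gamma_ne_zero_of_re_pos h2
  have := sub_ne_zero.mpr h1
  have := Real.rpow_pos_of_pos Real.pi_pos (-s.re / 2)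
  positivity

theorem xi_ne_zero_of_one_le_re {s : ℂ} (hs : 1 ≤ s.re) : xi s ≠ 0 :=
  xi_ne_zero_of_riemannZeta_ne_zero (by linarith) (riemannZeta_ne_zero_of_one_le_re hs)

theorem xi_ne_zero_of_riemannHypothesis (hRH : RiemannHypothesis) {s : ℂ} (hs : 1 / 2 < s.re) :
    xi s ≠ 0 := by
  rcases eq_or_ne s 1 with rfl | h1
  · simp [xi]
  refine xi_ne_zero_of_riemannZeta_ne_zero (by linarith) fun h ↦ ?_
  refine hs.ne' (hRH s h ?_ h1)
  rintro ⟨n, rfl⟩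
  simp at hs
  linarith [n.cast_nonneg (α := ℝ)]

/-- `f` grows at most like `exp (C (1 + |s|) ^ (3 / 2))`. -/
def OrderBound (f : ℂ → ℂ) : Prop :=
  ∃ C : ℝ, 0 ≤ C ∧ ∀ s, ‖f s‖ ≤ Real.exp (C * (1 + ‖s‖) ^ (3 / 2 : ℝ))

theorem one_add_norm_le_rpow (s : ℂ) : 1 + ‖s‖ ≤ (1 + ‖s‖) ^ (3 / 2 : ℝ) :=
  Real.self_le_rpow_of_one_le (by linarith [norm_nonneg s]) (by norm_num)

theorem one_le_rpow (s : ℂ) : 1 ≤ (1 + ‖s‖) ^ (3 / 2 : ℝ) :=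
  Real.one_le_rpow (by linarith [norm_nonneg s]) (by norm_num)

theorem OrderBound.comp_add {f : ℂ → ℂ} (hf : OrderBound f) (a : ℂ) :
    OrderBound fun s ↦ f (s + a) := by
  obtain ⟨C, hC, h⟩ := hf
  refine ⟨C * (1 + ‖a‖) ^ (3 / 2 : ℝ), by positivity, fun s ↦ (h _).trans ?_⟩
  rw [mul_assoc, ← Real.mul_rpow (by positivity) (by positivity)]
  gcongr
  have := norm_add_le s a
  nlinarith [norm_nonneg s, norm_nonneg a]

theorem OrderBound.const_mul {f : ℂ → ℂ} (hf : OrderBound f) (a : ℂ) :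
    OrderBound fun s ↦ a * f s := by
  obtain ⟨C, hC, h⟩ := hf
  refine ⟨‖a‖ + C, by positivity, fun s ↦ ?_⟩
  rw [norm_mul, add_mul, Real.exp_add]
  gcongr
  · have := Real.add_one_le_exp (‖a‖ * (1 + ‖s‖) ^ (3 / 2 : ℝ))
    have := one_le_rpow s
    nlinarith [norm_nonneg a]
  · exact h s

theorem OrderBound.add {f g : ℂ → ℂ} (hf : OrderBound f) (hg : OrderBound g) :
    OrderBound fun s ↦ f s + g s := by
  obtain ⟨C, hC, h⟩ := hf
  obtain ⟨D, hD, h'⟩ := hg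
  refine ⟨1 + (C + D), by positivity, fun s ↦ (norm_add_le _ _).trans ?_⟩
  have h1 := one_le_rpow s
  set r := (1 + ‖s‖) ^ (3 / 2 : ℝ)
  have h2 : Real.exp (C * r) ≤ Real.exp ((C + D) * r) := by gcongr; linarith
  have h3 : Real.exp (D * r) ≤ Real.exp ((C + D) * r) := by gcongr; linarith
  have h4 : (2 : ℝ) ≤ Real.exp (1 * r) := by linarith [Real.add_one_le_exp (1 * r)]
  have h5 := Real.exp_pos ((C + D) * r)
  rw [add_mul, Real.exp_add]
  nlinarith [h s, h' s]

/-- The Mellin integral converges for every exponent, and in a strip it is dominated by the sum of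
the integrands at the two edges, `s / 2 = ±2`. -/
theorem exists_norm_completedRiemannZeta₀_le :
    ∃ M : ℝ, 0 ≤ M ∧ ∀ s : ℂ, |s.re| ≤ 4 → ‖completedRiemannZeta₀ s‖ ≤ M := by
  set P := HurwitzZeta.hurwitzEvenFEPair 0
  have hconv (s : ℂ) : MellinConvergent P.f_modif s :=
    (P.isStrongFEPair_toStrongFEPair.hasMellin s).1
  have hint (x : ℝ) : MeasureTheory.IntegrableOn
      (fun t : ℝ ↦ t ^ (x - 1) * ‖P.f_modif t‖) (Set.Ioi 0) := by
    refine (MeasureTheory.IntegrableOn.congr_fun (hconv x).norm (fun t (ht : 0 < t) ↦ ?_)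
      measurableSet_Ioi)
    simp only [norm_smul]
    rw [norm_cpow_eq_rpow_re_of_pos ht]
    simp
  refine ⟨(∫ t in Set.Ioi (0 : ℝ), (t ^ (-2 - 1 : ℝ) * ‖P.f_modif t‖ +
    t ^ (2 - 1 : ℝ) * ‖P.f_modif t‖)) / 2, ?_, fun s hs ↦ ?_⟩
  · refine div_nonneg (MeasureTheory.setIntegral_nonneg measurableSet_Ioi fun t (ht : 0 < t) ↦ ?_)
      zero_le_two
    positivity
  · rw [completedRiemannZeta₀_eq_mellin, norm_div, RCLike.norm_ofNat, mellin]
    gcongr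
    refine MeasureTheory.norm_integral_le_of_norm_le ((hint (-2)).add (hint 2)) ?_
    refine (MeasureTheory.ae_restrict_iff' measurableSet_Ioi).mpr (.of_forall fun t (ht : 0 < t) ↦ ?_)
    rw [norm_smul, norm_cpow_eq_rpow_re_of_pos ht, ← add_mul]
    refine mul_le_mul_of_nonneg_right ?_ (norm_nonneg _)
    rw [abs_le] at hs
    have hre : (s / 2 - 1).re = s.re / 2 - 1 := by simp
    rw [hre]
    rcases le_total t 1 with h | h
    · refine (Real.rpow_le_rpow_of_exponent_ge ht h (?_ : (-2 - 1 : ℝ) ≤ _)).trans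
        (le_add_of_nonneg_right (by positivity))
      linarith
    · refine (Real.rpow_le_rpow_of_exponent_le h (?_ : _ ≤ (2 - 1 : ℝ))).trans
        (le_add_of_nonneg_left (by positivity))
      linarith

theorem exists_norm_xi_le_strip :
    ∃ C : ℝ, 0 ≤ C ∧ ∀ s : ℂ, |s.re| ≤ 4 → ‖xi s‖ ≤ Real.exp (C * (1 + ‖s‖) ^ (3 / 2 : ℝ)) := by
  obtain ⟨M, hM, h⟩ := exists_norm_completedRiemannZeta₀_le
  refine ⟨2 + M, by positivity, fun s hs ↦ ?_⟩
  have h1 := one_add_norm_le_rpow s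
  have h2 := one_le_rpow s
  set r := (1 + ‖s‖) ^ (3 / 2 : ℝ)
  have h3 : ‖xi s‖ ≤ ((1 + ‖s‖) * (1 + ‖s‖)) * (1 + M) := by
    rw [xi, norm_div, RCLike.norm_ofNat, div_le_iff₀ two_pos]
    refine (norm_add_le _ _).trans ?_
    rw [norm_mul, norm_mul, norm_one]
    have h4 : ‖s - 1‖ ≤ 1 + ‖s‖ := (norm_sub_le _ _).trans (by simp [add_comm])
    have h5 : ‖s‖ * ‖s - 1‖ * ‖completedRiemannZeta₀ s‖ ≤ (1 + ‖s‖) * (1 + ‖s‖) * M := by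
      gcongr
      · linarith
      · exact h s hs
    have h6 : 0 ≤ (1 + ‖s‖) * (1 + ‖s‖) * M := by positivity
    nlinarith [norm_nonneg s]
  refine h3.trans ?_
  have h7 : 1 + ‖s‖ ≤ Real.exp r := by linarith [Real.add_one_le_exp r]
  have h8 : 1 + M ≤ Real.exp (M * r) := by
    have := Real.add_one_le_exp (M * r)
    nlinarith
  calc _ ≤ (Real.exp r * Real.exp r) * Real.exp (M * r) := by gcongr
    _ = _ := by
      rw [← Real.exp_add, ← Real.exp_add]
      ring_nf

theorem norm_xi_le_of_four_le_re {s : ℂ} (hs : 4 ≤ s.re) :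
    ‖xi s‖ ≤ Real.exp (4 * (1 + ‖s‖) ^ (3 / 2 : ℝ)) := by
  have h1 := one_add_norm_le_rpow s
  have h2 := one_le_rpow s
  have hs1 : s ≠ 1 := fun h ↦ by
    rw [h] at hs
    norm_num at hs
  rw [norm_xi (by linarith) hs1]
  have hσ : (s / 2).re = s.re / 2 := by simp
  have h4 : ‖s - 1‖ ≤ 1 + ‖s‖ := (norm_sub_le _ _).trans (by simp [add_comm])
  have h5 : ‖Gamma (s / 2)‖ ≤ Real.exp (2 * (1 + ‖s‖) ^ (3 / 2 : ℝ)) := by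
    refine (norm_Gamma_le (by rw [hσ]; linarith)).trans
      ((realGamma_le (by rw [hσ]; linarith)).trans ?_)
    have := re_le_norm s
    have := norm_nonneg s
    rw [hσ]
    gcongr
    linarith
  have h6 : Real.pi ^ (-s.re / 2) ≤ 1 :=
    Real.rpow_le_one_of_one_le_of_nonpos (by linarith [Real.pi_gt_three]) (by linarith)
  have h7 := norm_riemannZeta_le (s := s) (by linarith)
  set r := (1 + ‖s‖) ^ (3 / 2 : ℝ)
  have h8 : 1 + ‖s‖ ≤ Real.exp r := by linarith [Real.add_one_le_exp r]
  calc _ ≤ 1 / 2 * Real.exp r * Real.exp r * 1 * Real.exp (2 * r) * 2 := by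
        gcongr <;> linarith
    _ = Real.exp r * Real.exp r * Real.exp (2 * r) := by ring
    _ = _ := by
      rw [← Real.exp_add, ← Real.exp_add]
      ring_nf

theorem orderBound_xi : OrderBound xi := by
  obtain ⟨C, hC, h⟩ := exists_norm_xi_le_strip
  have right (s : ℂ) (hs : -4 ≤ s.re) : ‖xi s‖ ≤ Real.exp ((C + 4) * (1 + ‖s‖) ^ (3 / 2 : ℝ)) := by
    have := one_le_rpow s
    by_cases h4 : s.re ≤ 4
    · refine (h s (abs_le.mpr ⟨hs, h4⟩)).trans ?_
      gcongr
      linarith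
    · refine (norm_xi_le_of_four_le_re (by linarith)).trans ?_
      gcongr
      linarith
  refine ⟨(C + 4) * 2 ^ (3 / 2 : ℝ), by positivity, fun s ↦ ?_⟩
  rw [mul_assoc, ← Real.mul_rpow (by positivity) (by positivity)]
  by_cases hs : -4 ≤ s.re
  · refine (right s hs).trans ?_
    gcongr
    linarith [norm_nonneg s]
  · rw [← xi_one_sub]
    refine (right (1 - s) (by simp; linarith)).trans ?_
    have : ‖1 - s‖ ≤ 1 + ‖s‖ := (norm_sub_le _ _).trans (by simp)
    gcongr
    linarith [norm_nonneg s]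

theorem exists_exp_le_norm_xi :
    ∃ C : ℝ, 0 ≤ C ∧ ∀ s : ℂ, 2 ≤ s.re → Real.exp (-C * (1 + ‖s‖)) ≤ ‖xi s‖ := by
  obtain ⟨C, hC, h⟩ := exists_exp_le_norm_Gamma
  refine ⟨C + Real.log Real.pi + 1 + Real.log 3, by
    have := Real.log_nonneg (x := Real.pi) (by linarith [Real.pi_gt_three])
    have := Real.log_nonneg (x := 3) (by norm_num)
    positivity, fun s hs ↦ ?_⟩
  have hs1 : s ≠ 1 := fun h ↦ by
    rw [h] at hs
    norm_num at hs
  rw [norm_xi (by linarith) hs1]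
  have h1 : Real.exp (-C * (1 + ‖s‖)) ≤ ‖Gamma (s / 2)‖ := by
    refine le_trans ?_ (h _ (by simp; linarith))
    rw [Real.exp_le_exp, norm_div, RCLike.norm_ofNat]
    nlinarith [norm_nonneg s]
  have h2 : 2 ≤ ‖s‖ := hs.trans (re_le_norm s)
  have h3 : 1 ≤ ‖s - 1‖ := by
    refine le_trans ?_ (re_le_norm _)
    simp
    linarith
  have h4 : Real.exp (-Real.log Real.pi * (1 + ‖s‖)) ≤ Real.pi ^ (-s.re / 2) := by
    rw [Real.rpow_def_of_pos Real.pi_pos, Real.exp_le_exp]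
    have := Real.log_nonneg (x := Real.pi) (by linarith [Real.pi_gt_three])
    have := re_le_norm s
    nlinarith
  have h5 : Real.exp (-Real.log 3 * (1 + ‖s‖)) ≤ ‖riemannZeta s‖ := by
    refine le_trans ?_ (le_norm_riemannZeta hs)
    rw [one_div, ← Real.exp_log (show (0 : ℝ) < 3 by norm_num), ← Real.exp_neg, Real.exp_le_exp,
      Real.log_exp]
    have := Real.log_nonneg (x := 3) (by norm_num)
    nlinarith
  calc _ ≤ Real.exp (-Real.log Real.pi * (1 + ‖s‖)) * Real.exp (-C * (1 + ‖s‖)) *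
          Real.exp (-Real.log 3 * (1 + ‖s‖)) := by
        rw [← Real.exp_add, ← Real.exp_add, Real.exp_le_exp]
        nlinarith
    _ = 1 / 2 * 2 * 1 * Real.exp (-Real.log Real.pi * (1 + ‖s‖)) * Real.exp (-C * (1 + ‖s‖)) *
          Real.exp (-Real.log 3 * (1 + ‖s‖)) := by ring
    _ ≤ _ := by gcongr

/-- On the real axis `ξ` grows faster than any exponential. -/
theorem exists_exp_lt_norm_xi (C : ℝ) : ∃ x : ℝ, Real.exp (C * (1 + |x|)) < ‖xi x‖ := by
  -- At `x = 2n` the Gamma factor contributes `n · Γ(n) = n!`, which beats the geometric `π ^ n`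
  -- from `π ^ (-s/2)` and `e^{2Cn}` from the target.
  have h := FloorSemiring.tendsto_pow_div_factorial_atTop (Real.pi * Real.exp (2 * C))
  obtain ⟨n, hn, hn1⟩ := ((h.eventually (gt_mem_nhds
    (show (0 : ℝ) < Real.exp (-C) / 3 by positivity))).and (Filter.eventually_ge_atTop 1)).exists
  have hn1' : (1 : ℝ) ≤ n := by exact_mod_cast hn1
  refine ⟨2 * n, ?_⟩
  have hre : (((2 * n : ℝ) : ℂ)).re = 2 * n := ofReal_re _
  have h2 : (((2 * n : ℝ) : ℂ)) - 1 = ((2 * n - 1 : ℝ) : ℂ) := by push_cast; ring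
  have h3 : (((2 * n : ℝ) : ℂ)) / 2 = ((n : ℝ) : ℂ) := by push_cast; ring
  have hne : (((2 * n : ℝ) : ℂ)) ≠ 1 := fun h ↦ by
    have := congrArg re h
    rw [hre] at this
    simp at this
    linarith
  have hζ := le_norm_riemannZeta (s := ((2 * n : ℝ) : ℂ)) (by rw [hre]; linarith)
  rw [norm_xi (by rw [hre]; linarith) hne, h2, h3, hre, Gamma_ofReal,
    Complex.norm_of_nonneg (by linarith), Complex.norm_of_nonneg (by linarith),
    Complex.norm_of_nonneg (Real.Gamma_pos_of_pos (by linarith)).le,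
    abs_of_nonneg (by linarith)]
  have hG : Real.Gamma n * n = n.factorial := by
    rw [mul_comm, ← Real.Gamma_add_one (by linarith), Real.Gamma_nat_eq_factorial]
  have hpi : Real.pi ^ (-(2 * n : ℝ) / 2) = (Real.pi ^ n)⁻¹ := by
    rw [← Real.rpow_natCast, ← Real.rpow_neg Real.pi_pos.le]
    congr 1
    ring
  have hf : (0 : ℝ) < n.factorial := by exact_mod_cast n.factorial_pos
  rw [div_lt_iff₀ hf, mul_pow, Real.exp_neg] at hn
  rw [hpi]
  have e1 : Real.exp (C * (1 + 2 * n)) = Real.exp C * Real.exp (2 * C) ^ n := by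
    rw [← Real.exp_nat_mul, ← Real.exp_add]
    ring_nf
  calc Real.exp (C * (1 + 2 * n)) < (Real.pi ^ n)⁻¹ * n.factorial * (1 / 3) := by
        rw [e1]
        have hp : 0 < Real.pi ^ n := by positivity
        have := mul_lt_mul_of_pos_left hn (mul_pos (Real.exp_pos C) (inv_pos.mpr hp))
        convert! this using 1 <;> field_simp
    _ = 1 * (Real.pi ^ n)⁻¹ * (Real.Gamma n * n) * (1 / 3) := by rw [hG]; ring
    _ ≤ (2 * n - 1) * (Real.pi ^ n)⁻¹ * (Real.Gamma n * n) * ‖riemannZeta (2 * n : ℝ)‖ := by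
        have := Real.Gamma_pos_of_pos (show (0 : ℝ) < n by linarith)
        have : 0 ≤ 2 * (n : ℝ) - 1 := by linarith
        gcongr
        linarith
    _ = _ := by ring

/-- Boundedness of the quotient on the real axis, as Phragmén–Lindelöf needs it. `Γ` increases on
`[2, ∞)`, whence `4 + h`; the `6` is the ratio of the zeta bounds `2` and `1/3`. -/
theorem norm_xi_sub_le_mul_norm_xi_add {h : ℝ} (hh : 0 ≤ h) {x : ℝ} (hx : 4 + h ≤ x) :
    ‖xi ((x - h : ℝ))‖ ≤ 6 * Real.pi ^ h * ‖xi ((x + h : ℝ))‖ := by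
  have key (y : ℝ) (hy : 4 ≤ y) : ‖xi y‖ = 1 / 2 * y * (y - 1) * Real.pi ^ (-y / 2) *
      Real.Gamma (y / 2) * ‖riemannZeta y‖ := by
    have h2 : (y : ℂ) - 1 = ((y - 1 : ℝ) : ℂ) := by push_cast; ring
    have h3 : (y : ℂ) / 2 = ((y / 2 : ℝ) : ℂ) := by push_cast; ring
    rw [norm_xi (by simp; linarith) (by norm_cast; linarith), h2, h3, Gamma_ofReal,
      Complex.norm_of_nonneg (by linarith), Complex.norm_of_nonneg (by linarith),
      Complex.norm_of_nonneg (Real.Gamma_pos_of_pos (by linarith)).le, ofReal_re]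
  rw [key _ (by linarith), key _ (by linarith)]
  have h1 : Real.pi ^ (-(x - h) / 2) = Real.pi ^ h * Real.pi ^ (-(x + h) / 2) := by
    rw [← Real.rpow_add Real.pi_pos]
    ring_nf
  have h2 : Real.Gamma ((x - h) / 2) ≤ Real.Gamma ((x + h) / 2) :=
    Real.Gamma_strictMonoOn_Ici.monotoneOn (Set.mem_Ici.mpr (by linarith))
      (Set.mem_Ici.mpr (by linarith)) (by linarith)
  have h3 : ‖riemannZeta ((x - h : ℝ))‖ ≤ 6 * ‖riemannZeta ((x + h : ℝ))‖ := by
    have := norm_riemannZeta_le (s := ((x - h : ℝ))) (by rw [ofReal_re]; linarith)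
    have := le_norm_riemannZeta (s := ((x + h : ℝ))) (by rw [ofReal_re]; linarith)
    linarith
  have h4 := Real.Gamma_pos_of_pos (show 0 < (x - h) / 2 by linarith)
  rw [h1]
  calc _ ≤ 1 / 2 * (x + h) * (x + h - 1) * (Real.pi ^ h * Real.pi ^ (-(x + h) / 2)) *
        Real.Gamma ((x + h) / 2) * (6 * ‖riemannZeta ((x + h : ℝ))‖) := by
        have : 0 ≤ x - h - 1 := by linarith
        have : 0 ≤ x + h := by linarith
        have : 0 ≤ x + h - 1 := by linarith
        have := Real.Gamma_pos_of_pos (show 0 < (x + h) / 2 by linarith)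
        gcongr <;> linarith
    _ = _ := by ring

open Metric Set

/-! ### Holomorphic functions without zeros -/

/-- A primitive `g` of `f'/f`, normalised at `c`, makes `e^{-g} f` constant. -/
theorem exists_log_of_isExactOn {f : ℂ → ℂ} {U : Set ℂ} (hU : IsOpen U) (hUc : IsPreconnected U)
    (hf : DifferentiableOn ℂ f U) (h0 : ∀ z ∈ U, f z ≠ 0)
    (hex : IsExactOn (fun z ↦ deriv f z / f z) U) {c : ℂ} (hc : c ∈ U) :
    ∃ g : ℂ → ℂ, DifferentiableOn ℂ g U ∧ ∀ z ∈ U, exp (g z) = f z := by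
  obtain ⟨g, hgc, hg⟩ := hex.with_val_at c (log (f c))
  refine ⟨g, fun z hz ↦ (hg z hz).differentiableAt.differentiableWithinAt, ?_⟩
  have hd : ∀ z ∈ U, HasDerivAt (fun z ↦ exp (-g z) * f z) 0 z := by
    intro z hz
    have h1 := ((hf z hz).differentiableAt (hU.mem_nhds hz)).hasDerivAt
    convert! (hg z hz).neg.cexp.mul h1 using 1
    have := h0 z hz
    field_simp
    ring
  have hconst : EqOn (fun z ↦ exp (-g z) * f z) (fun _ ↦ 1) U := by
    refine hU.eqOn_of_deriv_eq hUc
      (fun z hz ↦ (hd z hz).differentiableAt.differentiableWithinAt)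
      (differentiableOn_const _) (fun z hz ↦ by simp [(hd z hz).deriv]) hc ?_
    simp only [hgc]
    rw [exp_neg, exp_log (h0 c hc), inv_mul_cancel₀ (h0 c hc)]
  intro z hz
  have := hconst hz
  simp only [exp_neg] at this
  field_simp at this
  exact this.symm

theorem exists_log_ball {f : ℂ → ℂ} {c : ℂ} {R : ℝ} (hR : 0 < R)
    (hf : DifferentiableOn ℂ f (ball c R)) (h0 : ∀ z ∈ ball c R, f z ≠ 0) :
    ∃ g : ℂ → ℂ, DifferentiableOn ℂ g (ball c R) ∧ ∀ z ∈ ball c R, exp (g z) = f z :=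
  exists_log_of_isExactOn isOpen_ball (convex_ball c R).isPreconnected hf h0
    ((hf.deriv isOpen_ball).div hf h0).isExactOn_ball (mem_ball_self hR)

theorem exists_log_entire {f : ℂ → ℂ} (hf : Differentiable ℂ f) (h0 : ∀ z, f z ≠ 0) :
    ∃ g : ℂ → ℂ, Differentiable ℂ g ∧ ∀ z, exp (g z) = f z := by
  obtain ⟨g, hg, h⟩ := exists_log_of_isExactOn isOpen_univ isPreconnected_univ hf.differentiableOn
    (fun z _ ↦ h0 z) (Differentiable.isExactOn_univ
      (f := fun z ↦ deriv f z / f z) (hf.deriv.div hf h0)) (mem_univ 0)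
  exact ⟨g, differentiableOn_univ.mp hg, fun z ↦ h z (mem_univ z)⟩

/-- A lower bound for a zero-free holomorphic function in a disc, from an upper bound. -/
theorem mul_exp_le_norm_of_ne_zero {f : ℂ → ℂ} {c : ℂ} {R M : ℝ} (hM : 0 < M)
    (hf : DifferentiableOn ℂ f (ball c R)) (h0 : ∀ z ∈ ball c R, f z ≠ 0)
    (hb : ∀ z ∈ ball c R, ‖f z‖ ≤ Real.exp M * ‖f c‖) {z : ℂ} (hz : z ∈ ball c R) :
    ‖f c‖ * Real.exp (-(2 * M * ‖z - c‖ / (R - ‖z - c‖))) ≤ ‖f z‖ := by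
  have hR : 0 < R := pos_of_mem_ball hz
  obtain ⟨g, hg, hexp⟩ := exists_log_ball hR hf h0
  have hmaps : MapsTo (fun w ↦ c + w) (ball 0 R) (ball c R) := by
    intro w hw
    simpa using hw
  have hn (w : ℂ) (hw : w ∈ ball c R) : ‖f w‖ = Real.exp (g w).re := by
    rw [← hexp w hw, norm_exp]
  have hc := mem_ball_self (x := c) hR
  have hd : DifferentiableOn ℂ (fun w ↦ g (c + w) - g c) (ball 0 R) :=
    (hg.comp (by fun_prop) hmaps).sub_const _
  have hre : MapsTo (fun w ↦ g (c + w) - g c) (ball 0 R) {z | z.re ≤ M} := by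
    intro w hw
    have h1 := hb _ (hmaps hw)
    rw [hn _ (hmaps hw), hn _ hc, ← Real.exp_add, Real.exp_le_exp] at h1
    simp only [mem_ofPred_eq, sub_re]
    linarith
  have hz' : z - c ∈ ball (0 : ℂ) R := by
    rw [mem_ball, dist_zero_right, ← dist_eq_norm]
    exact hz
  have h2 := borelCaratheodory_zero hM hd hre hR hz' (by simp)
  rw [add_sub_cancel] at h2
  rw [hn _ hc, hn _ hz, ← Real.exp_add, Real.exp_le_exp]
  have h3 := (abs_le.mp (abs_re_le_norm (g z - g c))).1
  simp only [sub_re] at h3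
  linarith

/-! ### Entire functions of order less than two with finitely many zeros -/

theorem differentiable_dslope {f : ℂ → ℂ} (hf : Differentiable ℂ f) (c : ℂ) :
    Differentiable ℂ (dslope f c) :=
  differentiableOn_univ.mp
    ((differentiableOn_dslope (Filter.univ_mem' fun _ ↦ mem_univ _)).mpr hf.differentiableOn)

theorem exists_norm_sub_le_of_re_le {g : ℂ → ℂ} (hg : Differentiable ℂ g) {C : ℝ} (hC : 0 ≤ C)
    (h : ∀ z, (g z).re ≤ C * (1 + ‖z‖) ^ (3 / 2 : ℝ)) :
    ∃ D : ℝ, 0 ≤ D ∧ ∀ z, ‖g z - g 0‖ ≤ D * (1 + ‖z‖) ^ (3 / 2 : ℝ) := by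
  refine ⟨2 * (C * 2 ^ (3 / 2 : ℝ) + ‖g 0‖ + 1), by positivity, fun z ↦ ?_⟩
  have h1 := one_le_rpow z
  set M := C * (2 * (1 + ‖z‖)) ^ (3 / 2 : ℝ) + ‖g 0‖ + 1
  have hM : 0 < M := by positivity
  -- With radius `R = 2‖z‖ + 1`, the Borel–Carathéodory factor `‖z‖ / (R - ‖z‖)` is at most one.
  have hre : MapsTo (fun w ↦ g w - g 0) (ball 0 (2 * ‖z‖ + 1)) {z | z.re ≤ M} := by
    intro w hw
    rw [mem_ball, dist_zero_right] at hw
    have h2 : C * (1 + ‖w‖) ^ (3 / 2 : ℝ) ≤ C * (2 * (1 + ‖z‖)) ^ (3 / 2 : ℝ) := by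
      gcongr
      linarith
    have h3 := (abs_le.mp (abs_re_le_norm (g 0))).1
    simp only [mem_ofPred_eq, sub_re]
    linarith [h w]
  have h4 := borelCaratheodory_zero hM (hg.sub_const (g 0)).differentiableOn hre (by positivity)
    (z := z) (by rw [mem_ball, dist_zero_right]; linarith [norm_nonneg z]) (by simp)
  refine h4.trans ?_
  rw [div_le_iff₀ (by linarith [norm_nonneg z])]
  calc 2 * M * ‖z‖ ≤ 2 * M * (2 * ‖z‖ + 1 - ‖z‖) := by
        gcongr
        linarith
    _ ≤ _ := by
      have : 0 ≤ 2 * ‖z‖ + 1 - ‖z‖ := by linarith [norm_nonneg z]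
      have hM' : M ≤ (C * 2 ^ (3 / 2 : ℝ) + ‖g 0‖ + 1) * (1 + ‖z‖) ^ (3 / 2 : ℝ) := by
        simp only [M]
        rw [Real.mul_rpow (by positivity) (by positivity)]
        have := le_mul_of_one_le_right (norm_nonneg (g 0)) h1
        linarith
      refine mul_le_mul_of_nonneg_right ?_ this
      linarith

theorem eq_affine_of_norm_sub_le {g : ℂ → ℂ} (hg : Differentiable ℂ g) {D : ℝ} (hD : 0 ≤ D)
    (h : ∀ z, ‖g z - g 0‖ ≤ D * (1 + ‖z‖) ^ (3 / 2 : ℝ)) :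
    ∃ a : ℂ, ∀ z, g z = g 0 + z * a := by
  set k := dslope g 0
  have hk : Differentiable ℂ k := differentiable_dslope hg 0
  set l := dslope k 0
  have hl : Differentiable ℂ l := differentiable_dslope hk 0
  have hgk (z : ℂ) : z * k z = g z - g 0 := by
    have := sub_smul_dslope g 0 z
    simpa using this
  have hkl (z : ℂ) : z * l z = k z - k 0 := by
    have := sub_smul_dslope k 0 z
    simpa using this
  -- The second divided difference at `0` is `O(‖z‖ ^ (-1/2))`, so it vanishes by Liouville.
  have hlim : Filter.Tendsto l (Filter.cocompact ℂ) (nhds 0) := by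
    have hn := tendsto_norm_cocompact_atTop (E := ℂ)
    have h1 : Filter.Tendsto (fun z : ℂ ↦ D * 2 ^ (3 / 2 : ℝ) * ‖z‖ ^ (-(1 / 2) : ℝ) +
        ‖k 0‖ * ‖z‖ ^ (-1 : ℝ)) (Filter.cocompact ℂ) (nhds 0) := by
      have h2 := ((tendsto_rpow_neg_atTop (y := 1 / 2) (by norm_num)).comp hn).const_mul
        (D * 2 ^ (3 / 2 : ℝ))
      have h3 := ((tendsto_rpow_neg_atTop (y := 1) (by norm_num)).comp hn).const_mul ‖k 0‖
      simpa using h2.add h3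
    refine squeeze_zero_norm' ?_ h1
    filter_upwards [hn.eventually (Filter.eventually_ge_atTop 1)] with z hz
    have hz0 : 0 < ‖z‖ := by linarith
    have e1 : ‖z‖ * ‖k z‖ ≤ D * (2 ^ (3 / 2 : ℝ) * ‖z‖ ^ (3 / 2 : ℝ)) := by
      rw [← norm_mul, hgk]
      refine (h z).trans ?_
      rw [← Real.mul_rpow (by positivity) (by positivity)]
      gcongr
      linarith
    have e2 : ‖z‖ * ‖l z‖ ≤ ‖k z‖ + ‖k 0‖ := by
      rw [← norm_mul, hkl]
      exact norm_sub_le _ _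
    have e3 : ‖z‖ ^ (3 / 2 : ℝ) = ‖z‖ * ‖z‖ * ‖z‖ ^ (-(1 / 2) : ℝ) := by
      rw [show (3 / 2 : ℝ) = 1 + 1 + -(1 / 2) by norm_num, Real.rpow_add hz0, Real.rpow_add hz0,
        Real.rpow_one]
    have e4 : ‖z‖ ^ (-1 : ℝ) = ‖z‖⁻¹ := Real.rpow_neg_one _
    rw [e3] at e1
    rw [e4]
    have e5 : ‖k z‖ ≤ ‖z‖ * (D * 2 ^ (3 / 2 : ℝ) * ‖z‖ ^ (-(1 / 2) : ℝ)) := by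
      refine le_of_mul_le_mul_left ?_ hz0
      linarith
    refine le_of_mul_le_mul_left ?_ hz0
    have e6 : ‖z‖ * (‖k 0‖ * ‖z‖⁻¹) = ‖k 0‖ := by field_simp
    rw [mul_add, e6]
    linarith
  have hl0 (z : ℂ) : l z = 0 := hl.apply_eq_of_tendsto_cocompact z hlim
  refine ⟨k 0, fun z ↦ ?_⟩
  have h1 := hkl z
  rw [hl0, mul_zero] at h1
  linear_combination -(hgk z) - z * h1

theorem OrderBound.exists_norm_le_exp_of_ne_zero {f : ℂ → ℂ} (hf : Differentiable ℂ f)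
    (hb : OrderBound f) (h0 : ∀ z, f z ≠ 0) :
    ∃ D : ℝ, 0 ≤ D ∧ ∀ z, ‖f z‖ ≤ Real.exp (D * (1 + ‖z‖)) := by
  obtain ⟨g, hg, hexp⟩ := exists_log_entire hf h0
  obtain ⟨C, hC, hb⟩ := hb
  obtain ⟨D, hD, h⟩ := exists_norm_sub_le_of_re_le hg hC fun z ↦ by
    have := hb z
    rwa [← hexp, norm_exp, Real.exp_le_exp] at this
  obtain ⟨a, ha⟩ := eq_affine_of_norm_sub_le hg hD h
  refine ⟨‖g 0‖ + ‖a‖, by positivity, fun z ↦ ?_⟩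
  rw [← hexp, norm_exp, Real.exp_le_exp]
  calc (g z).re ≤ ‖g z‖ := re_le_norm _
    _ ≤ ‖g 0‖ + ‖z‖ * ‖a‖ := by
      rw [ha, ← norm_mul]
      exact norm_add_le _ _
    _ ≤ _ := by
      have : 0 ≤ ‖g 0‖ * ‖z‖ := by positivity
      linarith [norm_nonneg a]

theorem OrderBound.dslope {f : ℂ → ℂ} (hf : Differentiable ℂ f) (hb : OrderBound f) {c : ℂ}
    (hc : f c = 0) : OrderBound (dslope f c) := by
  obtain ⟨C, hC, hb⟩ := hb
  obtain ⟨K, hK⟩ := (isCompact_closedBall c 1).exists_bound_of_continuousOn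
    (differentiable_dslope hf c).continuous.continuousOn
  refine ⟨C + |K|, by positivity, fun z ↦ ?_⟩
  have h1 := one_le_rpow z
  by_cases hz : z ∈ closedBall c 1
  · have h2 := Real.add_one_le_exp ((C + |K|) * (1 + ‖z‖) ^ (3 / 2 : ℝ))
    have h3 : |K| ≤ (C + |K|) * (1 + ‖z‖) ^ (3 / 2 : ℝ) := by
      nlinarith [abs_nonneg K]
    linarith [hK z hz, le_abs_self K]
  · have h2 := sub_smul_dslope f c z
    rw [hc, sub_zero, smul_eq_mul] at h2
    rw [mem_closedBall, dist_eq_norm, not_le] at hz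
    calc ‖_root_.dslope f c z‖ ≤ ‖z - c‖ * ‖_root_.dslope f c z‖ :=
          le_mul_of_one_le_left (norm_nonneg _) hz.le
      _ = ‖f z‖ := by rw [← norm_mul, h2]
      _ ≤ _ := hb z
      _ ≤ _ := by
        gcongr
        linarith [abs_nonneg K]

/-- An entire function of order less than two with finitely many zeros, all simple, is of
exponential type. -/
theorem OrderBound.exists_norm_le_exp {f : ℂ → ℂ} (hf : Differentiable ℂ f) (hb : OrderBound f)
    (Z : Finset ℂ) (hZ : ∀ z, f z = 0 → z ∈ Z ∧ deriv f z ≠ 0) :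
    ∃ D : ℝ, 0 ≤ D ∧ ∀ z, ‖f z‖ ≤ Real.exp (D * (1 + ‖z‖)) := by
  classical
  induction Z using Finset.induction_on generalizing f with
  | empty => exact hb.exists_norm_le_exp_of_ne_zero hf fun z hz ↦ by simpa using (hZ z hz).1
  | insert c Z _ ih =>
    by_cases hc : f c = 0
    · set g := _root_.dslope f c
      have hg : Differentiable ℂ g := differentiable_dslope hf c
      have hfg (z : ℂ) : f z = (z - c) * g z := by
        have := sub_smul_dslope f c z
        rw [hc, sub_zero, smul_eq_mul] at this
        exact this.symm
      have hgc : g c ≠ 0 := by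
        simp only [g, dslope_same]
        exact (hZ c hc).2
      obtain ⟨D, hD, h⟩ := ih hg (hb.dslope hf hc) fun z hz ↦ by
        have hfz : f z = 0 := by rw [hfg, hz, mul_zero]
        have hzc : z ≠ c := fun h ↦ hgc (h ▸ hz)
        refine ⟨(Finset.mem_insert.mp (hZ z hfz).1).resolve_left hzc, fun hd ↦ (hZ z hfz).2 ?_⟩
        have h1 : HasDerivAt f (1 * g z + (z - c) * deriv g z) z := by
          rw [funext hfg]
          exact ((hasDerivAt_id z).sub_const c).mul (hg z).hasDerivAt
        rw [h1.deriv, hz, hd]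
        ring
      refine ⟨1 + ‖c‖ + D, by positivity, fun z ↦ ?_⟩
      rw [hfg, norm_mul, add_mul, Real.exp_add]
      gcongr
      · refine (norm_sub_le _ _).trans ?_
        have := Real.add_one_le_exp ((1 + ‖c‖) * (1 + ‖z‖))
        nlinarith [norm_nonneg z, norm_nonneg c, mul_nonneg (norm_nonneg z) (norm_nonneg c)]
      · exact h z
    · refine ih hf hb fun z hz ↦ ⟨(Finset.mem_insert.mp (hZ z hz).1).resolve_left ?_, (hZ z hz).2⟩
      rintro rfl
      exact hc hz

/-! ### Boundary behaviour of functions bounded by one in a half-plane -/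

theorem exists_re_pos_and_re_mul_pow_pos {c : ℂ} (hc : c ≠ 0) {k : ℕ} (hk : 2 ≤ k) :
    ∃ u : ℂ, 0 < u.re ∧ 0 < (c * u ^ k).re := by
  have hk' : (2 : ℝ) ≤ k := by exact_mod_cast hk
  have hπ := Real.pi_pos
  have ha := abs_arg_le_pi c
  -- This direction turns the argument of `c * u ^ k` into `arg c / 4`, while `|arg u| ≤ 3π / (4k) ≤
  -- 3π / 8` because `k ≥ 2`.
  refine ⟨exp ((-(3 * arg c / (4 * k)) : ℝ) * I), ?_, ?_⟩
  · rw [exp_ofReal_mul_I_re]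
    have h1 : |3 * arg c / (4 * k)| < Real.pi / 2 := by
      rw [abs_div, abs_mul, abs_of_pos (show (0 : ℝ) < 3 by norm_num),
        abs_of_pos (show (0 : ℝ) < 4 * k by positivity), div_lt_iff₀ (by positivity)]
      nlinarith
    rw [abs_lt] at h1
    apply Real.cos_pos_of_mem_Ioo
    constructor <;> linarith
  · have h2 : c * exp ((-(3 * arg c / (4 * k)) : ℝ) * I) ^ k =
        (‖c‖ : ℝ) * exp ((arg c / 4 : ℝ) * I) := by
      nth_rewrite 1 [← norm_mul_exp_arg_mul_I c]
      rw [← exp_nat_mul, mul_assoc, ← exp_add]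
      congr 2
      have : (k : ℂ) ≠ 0 := by
        have : k ≠ 0 := by omega
        exact_mod_cast this
      push_cast
      field_simp
      ring
    rw [h2, re_ofReal_mul, exp_ofReal_mul_I_re]
    refine mul_pos (norm_pos_iff.mpr hc) (Real.cos_pos_of_mem_Ioo ?_)
    rw [abs_le] at ha
    constructor <;> linarith

/-- A nonconstant holomorphic function that is bounded by `1` in a closed half-plane and takes the
value `1` at a boundary point has a nonzero derivative with nonpositive real part there. -/
theorem deriv_of_norm_le_one_of_eq_one {G : ℂ → ℂ} {s₀ : ℂ} (hG : AnalyticAt ℂ G s₀)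
    (h1 : G s₀ = 1) (hle : ∀ s : ℂ, s₀.re ≤ s.re → ‖G s‖ ≤ 1)
    (hne : ¬ ∀ᶠ z in nhds s₀, G z = 1) :
    (deriv G s₀).re ≤ 0 ∧ deriv G s₀ ≠ 0 := by
  have hG1 : AnalyticAt ℂ (fun z ↦ G z - 1) s₀ := hG.sub analyticAt_const
  obtain ⟨k, g, hg, hg0, hev⟩ := hG1.exists_eventuallyEq_pow_smul_nonzero_iff.mpr
    (by simpa [sub_eq_zero] using hne)
  -- Since `G = 1 + (z - s₀) ^ k g`, a short move into the half-plane along such a `u` would make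
  -- `Re G > 1`. For `k ≥ 2` a forbidden `u` always exists, so `k = 1`.
  have claim (u : ℂ) (hu : 0 < u.re) : ¬ 0 < (g s₀ * u ^ k).re := by
    intro hpos
    have hcont : Filter.Tendsto (fun ε : ℝ ↦ s₀ + ε * u) (nhdsWithin 0 (Ioi 0)) (nhds s₀) := by
      have : Continuous (fun ε : ℝ ↦ s₀ + ε * u) := by fun_prop
      exact (this.tendsto' 0 s₀ (by simp)).mono_left nhdsWithin_le_nhds
    have hlim : Filter.Tendsto (fun ε : ℝ ↦ (g (s₀ + ε * u) * u ^ k).re)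
        (nhdsWithin 0 (Ioi 0)) (nhds (g s₀ * u ^ k).re) :=
      (continuous_re.tendsto _).comp ((hg.continuousAt.tendsto.comp hcont).mul_const _)
    obtain ⟨ε, ⟨hε1, hε2⟩, hε0⟩ := (((hlim.eventually (lt_mem_nhds hpos)).and
      (hcont.eventually hev)).and self_mem_nhdsWithin).exists
    have hε0' : (0 : ℝ) < ε := hε0
    have e1 : G (s₀ + ε * u) = 1 + ((ε ^ k : ℝ) : ℂ) * (g (s₀ + ε * u) * u ^ k) := by
      rw [add_sub_cancel_left, smul_eq_mul, mul_pow] at hε2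
      push_cast
      linear_combination hε2
    have e2 : (G (s₀ + ε * u)).re = 1 + ε ^ k * (g (s₀ + ε * u) * u ^ k).re := by
      rw [e1, add_re, one_re, re_ofReal_mul]
    have e3 := hle (s₀ + ε * u) (by
      rw [add_re, re_ofReal_mul]
      have := mul_pos hε0' hu
      linarith)
    have e4 := re_le_norm (G (s₀ + ε * u))
    have e5 := mul_pos (pow_pos hε0' k) hε1
    linarith
  have hk0 : k ≠ 0 := by
    rintro rfl
    have := hev.self_of_nhds
    simp [h1] at this
    exact hg0 this.symm
  have hk2 : ¬ 2 ≤ k := fun hk ↦ by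
    obtain ⟨u, hu, hu'⟩ := exists_re_pos_and_re_mul_pow_pos hg0 hk
    exact claim u hu hu'
  obtain rfl : k = 1 := by omega
  have hd : deriv G s₀ = g s₀ := by
    have h2 : HasDerivAt (fun z ↦ (z - s₀) * g z) (1 * g s₀ + (s₀ - s₀) * deriv g s₀) s₀ :=
      ((hasDerivAt_id s₀).sub_const s₀).mul hg.differentiableAt.hasDerivAt
    have h3 : G =ᶠ[nhds s₀] fun z ↦ (z - s₀) * g z + 1 := by
      filter_upwards [hev] with z hz
      rw [pow_one, smul_eq_mul] at hz
      linear_combination hz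
    rw [h3.deriv_eq, (h2.add_const 1).deriv]
    ring
  rw [hd]
  refine ⟨?_, hg0⟩
  simpa using claim 1 (by simp)

/-! ### The inequality `|ξ(s - h)| < |ξ(s + h)|` to the right of the critical line -/

/-- Controls the denominator of the quotient. Left of `Re s = 2`, the zero-free lower bound is
applied in the disc about `2 + i Im s` touching the line `Re z = σ`. -/
theorem exists_exp_le_norm_xi_of_ne_zero {σ δ : ℝ} (hσ : 1 / 2 ≤ σ) (hδ : 0 < δ)
    (h0 : ∀ s : ℂ, σ < s.re → xi s ≠ 0) :
    ∃ C : ℝ, 0 ≤ C ∧ ∀ s : ℂ, σ + δ ≤ s.re →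
      Real.exp (-C * (1 + ‖s‖) ^ (3 / 2 : ℝ)) ≤ ‖xi s‖ := by
  obtain ⟨C₁, hC₁, h₁⟩ := orderBound_xi
  obtain ⟨C₂, hC₂, h₂⟩ := exists_exp_le_norm_xi
  -- `4 ^ (3/2)` comes from `1 + ‖z‖ ≤ 4 (1 + ‖s‖)` on the disc, `4 * C₂` from the lower bound at
  -- its centre. Below, `3/2` bounds the distance from `s` to the centre and `δ` bounds from below
  -- that from `s` to the boundary circle.
  set K := C₁ * 4 ^ (3 / 2 : ℝ) + 4 * C₂ + 1
  refine ⟨4 * C₂ + 2 * K * (3 / 2) / δ, by positivity, fun s hs ↦ ?_⟩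
  have hr := one_le_rpow s
  have hr' := one_add_norm_le_rpow s
  have hn := norm_nonneg s
  by_cases hs2 : 2 ≤ s.re
  · refine le_trans ?_ (h₂ s hs2)
    rw [Real.exp_le_exp, neg_mul, neg_mul, neg_le_neg_iff]
    calc C₂ * (1 + ‖s‖) ≤ C₂ * (1 + ‖s‖) ^ (3 / 2 : ℝ) := by gcongr
      _ ≤ _ := by
        gcongr
        have : 0 ≤ 2 * K * (3 / 2) / δ := by positivity
        linarith
  · push Not at hs2
    set c : ℂ := 2 + s.im * I
    have hcre : c.re = 2 := by simp [c]
    have hsc : ‖s - c‖ = 2 - s.re := by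
      have : s - c = ((s.re - 2 : ℝ) : ℂ) := by
        apply Complex.ext <;> simp [c]
      rw [this, norm_real, Real.norm_eq_abs, abs_of_neg (by linarith)]
      ring
    have hc : ‖c‖ ≤ ‖s‖ + 3 / 2 := by
      have := norm_le_norm_add_norm_sub s c
      linarith
    set M := K * (1 + ‖s‖) ^ (3 / 2 : ℝ)
    have hM : 0 < M := by positivity
    have hre (z : ℂ) (hz : z ∈ ball c (2 - σ)) : σ < z.re := by
      rw [mem_ball, dist_eq_norm] at hz
      have := (abs_le.mp (abs_re_le_norm (z - c))).1
      rw [sub_re, hcre] at this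
      linarith
    have hlow : Real.exp (-(4 * C₂) * (1 + ‖s‖) ^ (3 / 2 : ℝ)) ≤ ‖xi c‖ := by
      refine le_trans ?_ (h₂ c hcre.ge)
      rw [Real.exp_le_exp, neg_mul, neg_mul, neg_le_neg_iff, mul_comm 4, mul_assoc]
      gcongr
      linarith
    have hup (z : ℂ) (hz : z ∈ ball c (2 - σ)) : ‖xi z‖ ≤ Real.exp M * ‖xi c‖ := by
      rw [mem_ball, dist_eq_norm] at hz
      have hz' : 1 + ‖z‖ ≤ 4 * (1 + ‖s‖) := by
        have := norm_le_norm_add_norm_sub c z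
        linarith [norm_sub_rev c z]
      calc ‖xi z‖ ≤ Real.exp (C₁ * (4 * (1 + ‖s‖)) ^ (3 / 2 : ℝ)) := by
            refine (h₁ z).trans ?_
            gcongr
        _ ≤ Real.exp M * Real.exp (-(4 * C₂) * (1 + ‖s‖) ^ (3 / 2 : ℝ)) := by
          rw [← Real.exp_add, Real.exp_le_exp, Real.mul_rpow (by norm_num) (by positivity)]
          simp only [M, K]
          linarith
        _ ≤ _ := by gcongr
    have hmem : s ∈ ball c (2 - σ) := by
      rw [mem_ball, dist_eq_norm, hsc]
      linarith
    have key := mul_exp_le_norm_of_ne_zero hM differentiable_xi.differentiableOn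
      (fun z hz ↦ h0 z (hre z hz)) hup hmem
    refine le_trans ?_ key
    calc _ = Real.exp (-(4 * C₂) * (1 + ‖s‖) ^ (3 / 2 : ℝ)) *
          Real.exp (-(2 * M * (3 / 2) / δ)) := by
          rw [← Real.exp_add]
          simp only [M]
          ring_nf
      _ ≤ _ := by
        gcongr
        · rw [hsc]
          linarith
        · rw [hsc]
          linarith

theorem xi_one_sub_conj (s : ℂ) : xi (1 - (starRingEnd ℂ) s) = (starRingEnd ℂ) (xi s) := by
  rw [xi_one_sub, xi_conj]

theorem deriv_xi_conj (s : ℂ) :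
    deriv xi ((starRingEnd ℂ) s) = (starRingEnd ℂ) (deriv xi s) := by
  have h : xi = (starRingEnd ℂ) ∘ xi ∘ (starRingEnd ℂ) := by
    ext z
    simp [xi_conj]
  conv_lhs => rw [h, deriv_conj_conj]
  simp

theorem xi_sub_of_re_eq_half {s : ℂ} (hs : s.re = 1 / 2) (h : ℝ) :
    xi (s - h) = (starRingEnd ℂ) (xi (s + h)) := by
  rw [← xi_one_sub_conj]
  congr 1
  apply Complex.ext
  · simp [hs]
    ring
  · simp

/-- Phragmén–Lindelöf for the quotient, moved to the half-plane `Re z > 0`. The strict inequality `σ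
< 1 / 2 + h` keeps the denominator a positive distance from the possible zeros. -/
theorem norm_xi_sub_le_of_ne_zero {h σ : ℝ} (hh : 0 < h) (hσ : 1 / 2 ≤ σ) (hσh : σ < 1 / 2 + h)
    (h0 : ∀ s : ℂ, σ < s.re → xi s ≠ 0) {s : ℂ} (hs : 1 / 2 ≤ s.re) :
    ‖xi (s - h)‖ ≤ ‖xi (s + h)‖ := by
  have hre (z : ℂ) (hz : 0 ≤ z.re) : 1 / 2 + h ≤ (z + (1 / 2 + h : ℝ)).re := by
    rw [add_re, ofReal_re]
    linarith
  have hne (z : ℂ) (hz : 0 ≤ z.re) : xi (z + (1 / 2 + h : ℝ)) ≠ 0 :=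
    h0 _ (hσh.trans_le (hre z hz))
  set f : ℂ → ℂ := fun z ↦ xi (z + (1 / 2 - h : ℝ)) / xi (z + (1 / 2 + h : ℝ))
  have hd : DiffContOnCl ℂ f {z | 0 < z.re} := by
    refine DifferentiableOn.diffContOnCl ?_
    rw [closure_setOfPred_lt_re]
    have := differentiable_xi
    exact DifferentiableOn.div (Differentiable.differentiableOn (by fun_prop))
      (Differentiable.differentiableOn (by fun_prop)) fun z hz ↦ hne z hz
  have hexp : ∃ c < (2 : ℝ), ∃ B, f =O[Bornology.cobounded ℂ ⊓ Filter.principal {z | 0 < z.re}]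
      fun z ↦ Real.exp (B * ‖z‖ ^ c) := by
    obtain ⟨C₁, hC₁, h₁⟩ := orderBound_xi.comp_add (1 / 2 - h : ℝ)
    obtain ⟨C₂, hC₂, h₂⟩ := exists_exp_le_norm_xi_of_ne_zero hσ
      (show 0 < 1 / 2 + h - σ by linarith) h0
    set a : ℂ := ((1 / 2 + h : ℝ) : ℂ)
    set D := C₂ * (1 + ‖a‖) ^ (3 / 2 : ℝ)
    refine ⟨3 / 2, by norm_num, (C₁ + D) * 2 ^ (3 / 2 : ℝ), Asymptotics.IsBigO.of_bound 1 ?_⟩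
    rw [Filter.eventually_inf_principal]
    filter_upwards [tendsto_norm_cobounded_atTop.eventually (Filter.eventually_ge_atTop 1)]
      with z hz hzre
    have hzre' : 0 < z.re := hzre
    rw [one_mul, Real.norm_of_nonneg (Real.exp_pos _).le, mul_assoc,
      ← Real.mul_rpow (by norm_num) (norm_nonneg _), norm_div,
      div_le_iff₀ (norm_pos_iff.mpr (hne z hzre'.le))]
    have e1 : Real.exp (-D * (1 + ‖z‖) ^ (3 / 2 : ℝ)) ≤ ‖xi (z + a)‖ := by
      refine le_trans ?_ (h₂ (z + a) (by linarith [hre z hzre'.le]))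
      rw [Real.exp_le_exp, neg_mul, neg_mul, neg_le_neg_iff, mul_assoc,
        ← Real.mul_rpow (by positivity) (by positivity)]
      gcongr
      have := norm_add_le z a
      nlinarith [norm_nonneg z, norm_nonneg a]
    calc _ ≤ Real.exp (C₁ * (1 + ‖z‖) ^ (3 / 2 : ℝ)) := h₁ z
      _ = Real.exp ((C₁ + D) * (1 + ‖z‖) ^ (3 / 2 : ℝ)) *
          Real.exp (-D * (1 + ‖z‖) ^ (3 / 2 : ℝ)) := by
        rw [← Real.exp_add]
        ring_nf
      _ ≤ _ := by
        gcongr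
        linarith
  have hreal : Filter.IsBoundedUnder (· ≤ ·) Filter.atTop fun x : ℝ ↦ ‖f x‖ := by
    refine ⟨6 * Real.pi ^ h, ?_⟩
    rw [Filter.eventually_map]
    filter_upwards [Filter.eventually_ge_atTop (4 + h)] with x hx
    have := norm_xi_sub_le_mul_norm_xi_add hh.le (show 4 + h ≤ x + 1 / 2 by linarith)
    simp only [f]
    rw [norm_div, div_le_iff₀ (norm_pos_iff.mpr (hne x (by rw [ofReal_re]; linarith)))]
    convert! this using 3
    · push_cast
      ring_nf
    · push_cast
      ring_nf
  have him (x : ℝ) : ‖f (x * I)‖ ≤ 1 := by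
    simp only [f]
    rw [norm_div]
    refine div_le_one_of_le₀ (le_of_eq ?_) (norm_nonneg _)
    have := xi_sub_of_re_eq_half (s := x * I + 1 / 2) (by simp) h
    have e1 : (x * I + 1 / 2 : ℂ) - h = x * I + (1 / 2 - h : ℝ) := by push_cast; ring
    have e2 : (x * I + 1 / 2 : ℂ) + h = x * I + (1 / 2 + h : ℝ) := by push_cast; ring
    rw [e1, e2] at this
    rw [this, norm_conj]
  have hs0 : 0 ≤ (s - 1 / 2).re := by simpa using hs
  have hfin := PhragmenLindelof.right_half_plane_of_bounded_on_real hd hexp hreal him hs0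
  simp only [f] at hfin
  rw [norm_div, div_le_one (norm_pos_iff.mpr (hne _ hs0))] at hfin
  convert! hfin using 3
  · push_cast
    ring
  · push_cast
    ring

/-- The shifts `h > 0` for which `ξ(s + h)` has no zeros in the closed half-plane to the right of
the critical line and dominates `ξ(s - h)` there. -/
structure IsDominatingShift (h : ℝ) : Prop where
  pos : 0 < h
  ne_zero : ∀ s : ℂ, 1 / 2 ≤ s.re → xi (s + h) ≠ 0
  norm_le : ∀ s : ℂ, 1 / 2 ≤ s.re → ‖xi (s - h)‖ ≤ ‖xi (s + h)‖

theorem isDominatingShift_of_half_le {h : ℝ} (hh : 1 / 2 ≤ h) : IsDominatingShift h := by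
  refine ⟨by linarith, fun s hs ↦ xi_ne_zero_of_one_le_re (by simp; linarith), fun s hs ↦ ?_⟩
  -- The zero-free bound `σ = 1` excludes `h = 1/2`, so the inequality is obtained for `t > h` and
  -- passed to the limit `t ↓ h`.
  have hc := differentiable_xi.continuous
  have h1 : Continuous fun t : ℝ ↦ ‖xi (s - t)‖ := by fun_prop
  have h2 : Continuous fun t : ℝ ↦ ‖xi (s + t)‖ := by fun_prop
  refine le_of_tendsto_of_tendsto ((h1.tendsto h).mono_left nhdsWithin_le_nhds)
    ((h2.tendsto h).mono_left (nhdsWithin_le_nhds (s := Ioi h))) ?_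
  filter_upwards [self_mem_nhdsWithin] with t ht
  have ht' : h < t := ht
  exact norm_xi_sub_le_of_ne_zero (σ := 1) (by linarith) (by norm_num) (by linarith)
    (fun z hz ↦ xi_ne_zero_of_one_le_re hz.le) hs

theorem isDominatingShift_of_riemannHypothesis (hRH : RiemannHypothesis) {h : ℝ} (hh : 0 < h) :
    IsDominatingShift h :=
  ⟨hh, fun s hs ↦ xi_ne_zero_of_riemannHypothesis hRH (by simp; linarith), fun _ hs ↦
    norm_xi_sub_le_of_ne_zero hh le_rfl (by linarith)
      (fun _ hz ↦ xi_ne_zero_of_riemannHypothesis hRH hz) hs⟩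

/-- By the identity theorem `|ξ|` would be `2h`-periodic on the real axis, hence bounded there,
against its growth. -/
theorem not_eventually_xi_sub_eq {h : ℝ} (hh : 0 < h) (s₀ : ℂ) {c : ℂ} (hc : ‖c‖ = 1) :
    ¬ ∀ᶠ z in nhds s₀, xi (z - h) = c * xi (z + h) := by
  intro hev
  have hx := differentiable_xi
  have h1 : (fun z ↦ xi (z - h)) = fun z ↦ c * xi (z + h) := by
    refine AnalyticOnNhd.eq_of_eventuallyEq (𝕜 := ℂ) (z₀ := s₀) (fun z _ ↦ ?_) (fun z _ ↦ ?_) hev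
    · exact Differentiable.analyticAt (by fun_prop) z
    · exact Differentiable.analyticAt (by fun_prop) z
  have hper : Function.Periodic (fun x : ℝ ↦ ‖xi x‖) (2 * h) := by
    intro x
    change ‖xi ((x + 2 * h : ℝ))‖ = ‖xi x‖
    have h2 := congrFun h1 (x + h)
    simp only [add_sub_cancel_right] at h2
    have e : (x : ℂ) + h + h = ((x + 2 * h : ℝ) : ℂ) := by push_cast; ring
    rw [h2, norm_mul, hc, one_mul, e]
  have hcont : Continuous (fun x : ℝ ↦ ‖xi x‖) := by
    have := hx.continuous
    fun_prop
  obtain ⟨K, hK⟩ := (hper.compact_of_continuous (by positivity) hcont).isBounded.bddAbove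
  obtain ⟨x, hx⟩ := exists_exp_lt_norm_xi |K|
  have h3 : ‖xi x‖ ≤ K := hK (mem_range_self x)
  have h4 := Real.add_one_le_exp (|K| * (1 + |x|))
  have h5 : 0 ≤ |K| * |x| := by positivity
  linarith [le_abs_self K]

namespace IsDominatingShift

variable {h : ℝ}

theorem norm_lt (hd : IsDominatingShift h) {s : ℂ} (hs : 1 / 2 < s.re) :
    ‖xi (s - h)‖ < ‖xi (s + h)‖ := by
  refine lt_of_le_of_ne (hd.norm_le s hs.le) fun heq ↦ ?_
  have hx := differentiable_xi
  set U : Set ℂ := {z | 1 / 2 < z.re}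
  have hUo : IsOpen U := isOpen_lt continuous_const continuous_re
  have hne (z : ℂ) (hz : z ∈ U) : xi (z + h) ≠ 0 := hd.ne_zero z (le_of_lt hz)
  set f : ℂ → ℂ := fun z ↦ xi (z - h) / xi (z + h)
  have hf : DifferentiableOn ℂ f U :=
    DifferentiableOn.div (Differentiable.differentiableOn (by fun_prop))
      (Differentiable.differentiableOn (by fun_prop)) hne
  have hfs : ‖f s‖ = 1 := by
    simp only [f]
    rw [norm_div, heq, div_self (norm_ne_zero_iff.mpr (hne s hs))]
  have hmax : IsMaxOn (norm ∘ f) U s := by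
    intro z hz
    simp only [Function.comp_apply, mem_ofPred_eq]
    rw [hfs]
    simp only [f]
    rw [norm_div]
    exact div_le_one_of_le₀ (hd.norm_le z (le_of_lt hz)) (norm_nonneg _)
  have hconst := eqOn_of_isPreconnected_of_isMaxOn_norm
    (convex_halfSpace_re_gt (1 / 2)).isPreconnected hUo hf hs hmax
  refine not_eventually_xi_sub_eq hd.pos s hfs ?_
  filter_upwards [hUo.mem_nhds hs] with z hz
  have := hconst hz
  simp only [f, Function.const_apply] at this
  rwa [div_eq_iff (hne z hz)] at this

theorem re_logDeriv_pos (hd : IsDominatingShift h) {s : ℂ} (hs : s.re = 1 / 2) :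
    0 < (deriv xi (s + h) / xi (s + h)).re := by
  have hx := differentiable_xi
  have hp : xi (s + h) ≠ 0 := hd.ne_zero s hs.ge
  have hconj := xi_sub_of_re_eq_half hs h
  have hm : xi (s - h) ≠ 0 := by
    rw [hconj]
    simpa using hp
  set L := deriv xi (s + h) / xi (s + h)
  have hderiv : deriv xi (s - h) = -(starRingEnd ℂ) (deriv xi (s + h)) := by
    have e1 : (s - h : ℂ) = 1 - (starRingEnd ℂ) (s + h) := by
      apply Complex.ext
      · simp [hs]
        ring
      · simp
    have e3 (z : ℂ) : deriv xi (1 - z) = -deriv xi z := by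
      have h3 := deriv_comp_const_sub (f := xi) 1 z
      simp only [xi_one_sub] at h3
      rw [h3, neg_neg]
    rw [e1, e3, deriv_xi_conj]
  -- The quotient rotated to take the value `1` at `s`. By the symmetries its derivative there is
  -- `-2 Re (ξ'/ξ)(s + h)`, to which the boundary lemma applies.
  set G : ℂ → ℂ := fun z ↦ xi (z - h) / xi (z + h) * (xi (s + h) / xi (s - h))
  have hG1 : G s = 1 := by
    simp only [G]
    field_simp
  have hdm : HasDerivAt (fun z : ℂ ↦ xi (z - h)) (deriv xi (s - h)) s :=
    (hx (s - h)).hasDerivAt.comp_sub_const s (h : ℂ)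
  have hdp : HasDerivAt (fun z : ℂ ↦ xi (z + h)) (deriv xi (s + h)) s :=
    (hx (s + h)).hasDerivAt.comp_add_const s (h : ℂ)
  have hG' : deriv G s = ((-(2 * L.re) : ℝ) : ℂ) := by
    have h1 := ((hdm.div hdp hp).mul_const (xi (s + h) / xi (s - h))).deriv
    have h2 : deriv G s = deriv xi (s - h) / xi (s - h) - L := by
      simp only [L]
      refine h1.trans ?_
      field_simp
    have h3 : deriv xi (s - h) / xi (s - h) = -(starRingEnd ℂ) L := by
      rw [hderiv, hconj, neg_div, map_div₀]
    rw [h2, h3]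
    push_cast
    rw [re_eq_add_conj]
    ring
  have hnorm : ‖xi (s + h) / xi (s - h)‖ = 1 := by
    rw [norm_div, hconj, norm_conj, div_self (norm_ne_zero_iff.mpr hp)]
  have hle (z : ℂ) (hz : s.re ≤ z.re) : ‖G z‖ ≤ 1 := by
    simp only [G]
    rw [norm_mul, hnorm, mul_one, norm_div]
    exact div_le_one_of_le₀ (hd.norm_le z (by linarith)) (norm_nonneg _)
  have han : AnalyticAt ℂ G s := by
    refine AnalyticAt.mul (AnalyticAt.div ?_ ?_ hp) analyticAt_const
    · exact Differentiable.analyticAt (by fun_prop) s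
    · exact Differentiable.analyticAt (by fun_prop) s
  have hnc : ¬ ∀ᶠ z in nhds s, G z = 1 := by
    intro hev
    have hnorm' : ‖xi (s - h) / xi (s + h)‖ = 1 := by
      rw [← inv_div, norm_inv, hnorm, inv_one]
    refine not_eventually_xi_sub_eq hd.pos s hnorm' ?_
    have hcont : ContinuousAt (fun z : ℂ ↦ xi (z + h)) s := hdp.continuousAt
    filter_upwards [hev, hcont.eventually_ne hp] with z hz hz0
    simp only [G] at hz
    field_simp at hz ⊢
    exact hz
  obtain ⟨h1, h2⟩ := deriv_of_norm_le_one_of_eq_one han hG1 hle hnc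
  rw [hG'] at h1 h2
  rw [ofReal_re] at h1
  rw [ofReal_ne_zero] at h2
  rcases lt_or_eq_of_le (show 0 ≤ L.re by linarith) with h3 | h3
  · exact h3
  · rw [← h3] at h2
    simp at h2

end IsDominatingShift

/-! ### The functions `A_{h,θ}` -/

theorem Arot_eq (h θ : ℝ) (s : ℂ) :
    Arot h θ s = 1 / 2 * (exp (θ * I) * xi (s + h) + exp (-(θ * I)) * xi (s - h)) := by
  have hB : -(1 / (2 * I)) = I / 2 := by
    field_simp
    simp
  rw [Arot, A, B, hB, ← neg_mul, exp_mul_I, exp_mul_I, cos_neg, sin_neg]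
  push_cast
  ring

theorem Brot_eq_Arot (h θ : ℝ) : Brot h θ = Arot h (θ + Real.pi / 2) := by
  ext s
  rw [Brot, Arot, Real.cos_add_pi_div_two, Real.sin_add_pi_div_two]
  push_cast
  ring

theorem Arot_neg (h θ : ℝ) : Arot (-h) θ = Arot h (-θ) := by
  ext s
  rw [Arot_eq, Arot_eq]
  push_cast
  rw [sub_neg_eq_add, ← sub_eq_add_neg, neg_mul, neg_neg]
  ring

theorem differentiable_Arot (h θ : ℝ) : Differentiable ℂ (Arot h θ) :=
  (differentiable_Arot_Brot h θ).1

theorem orderBound_Arot (h θ : ℝ) : OrderBound (Arot h θ) := by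
  have h1 := ((orderBound_xi.comp_add h).const_mul (exp (θ * I))).add
    ((orderBound_xi.comp_add (-h)).const_mul (exp (-(θ * I))))
  convert! h1.const_mul (1 / 2) using 2 with s
  rw [Arot_eq, sub_eq_add_neg]

namespace IsDominatingShift

variable {h : ℝ}

theorem re_eq_half_of_Arot_eq_zero (hd : IsDominatingShift h) {θ : ℝ} {s : ℂ}
    (hs : Arot h θ s = 0) : s.re = 1 / 2 := by
  have h1 : ‖xi (s + h)‖ = ‖xi (s - h)‖ := by
    rw [Arot_eq] at hs
    have h2 : exp (θ * I) * xi (s + h) = -(exp (-(θ * I)) * xi (s - h)) := by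
      linear_combination 2 * hs
    have h3 := congrArg norm h2
    rwa [norm_neg, norm_mul, norm_mul, norm_exp_ofReal_mul_I, ← neg_mul, ← ofReal_neg,
      norm_exp_ofReal_mul_I, one_mul, one_mul] at h3
  rcases lt_trichotomy s.re (1 / 2) with h2 | h2 | h2
  · have h3 := hd.norm_lt (s := 1 - s) (by simp; linarith)
    rw [sub_sub, xi_one_sub, show (1 - s + h : ℂ) = 1 - (s - h) by ring, xi_one_sub] at h3
    linarith
  · exact h2
  · linarith [hd.norm_lt h2]

/-! ### The phase on the critical line, and simplicity and abundance of the zeros -/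

theorem exists_log_line (hd : IsDominatingShift h) :
    ∃ W : ℝ → ℂ, (∀ t : ℝ, HasDerivAt W
      (I * (deriv xi (1 / 2 + I * t + h) / xi (1 / 2 + I * t + h))) t) ∧
      ∀ t : ℝ, xi (1 / 2 + I * t + h) = exp (W t) := by
  have hx := differentiable_xi
  have hne (t : ℝ) : xi (1 / 2 + I * t + h) ≠ 0 := hd.ne_zero _ (by simp)
  set l : ℝ → ℂ := fun t ↦ I * (deriv xi (1 / 2 + I * t + h) / xi (1 / 2 + I * t + h))
  have hl : Continuous l := by
    have h1 := hx.deriv.continuous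
    have h2 := hx.continuous
    refine continuous_const.mul (Continuous.div ?_ ?_ hne) <;> fun_prop
  set W : ℝ → ℂ := fun t ↦ log (xi (1 / 2 + I * (0 : ℝ) + h)) + ∫ u in (0 : ℝ)..t, l u
  have hW (t : ℝ) : HasDerivAt W (l t) t :=
    (intervalIntegral.integral_hasDerivAt_right (hl.intervalIntegrable _ _)
      hl.stronglyMeasurable.stronglyMeasurableAtFilter hl.continuousAt).const_add _
  refine ⟨W, hW, fun t ↦ ?_⟩
  have hE (t : ℝ) : HasDerivAt (fun t : ℝ ↦ xi (1 / 2 + I * t + h))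
      (deriv xi (1 / 2 + I * t + h) * I) t := by
    have h1 : HasDerivAt (fun t : ℝ ↦ (1 / 2 + I * t + h : ℂ)) I t := by
      simpa using (((hasDerivAt_id t).ofReal_comp.const_mul I).const_add (1 / 2)).add_const (h : ℂ)
    exact (hx _).hasDerivAt.comp t h1
  have hP (t : ℝ) : HasDerivAt (fun t : ℝ ↦ xi (1 / 2 + I * t + h) * exp (-W t)) 0 t := by
    convert! (hE t).mul (hW t).neg.cexp using 1
    have e : xi (1 / 2 + I * t + h) * l t = deriv xi (1 / 2 + I * t + h) * I := by
      simp only [l]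
      rw [mul_left_comm, mul_div_cancel₀ _ (hne t), mul_comm]
    simp only [Pi.neg_apply]
    linear_combination exp (-W t) * e
  have h2 := is_const_of_deriv_eq_zero (fun t ↦ (hP t).differentiableAt) (fun t ↦ (hP t).deriv) t 0
  have h3 : exp (W 0) = xi (1 / 2 + I * (0 : ℝ) + h) := by
    simp only [W, intervalIntegral.integral_same, add_zero]
    exact exp_log (hne 0)
  simp only [exp_neg] at h2
  rw [h3, mul_inv_cancel₀ (hne 0), mul_inv_eq_one₀ (exp_ne_zero _)] at h2
  exact h2

/-- The phase function of `ξ(1/2 + h + it)`, together with the resulting description of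
`A_{h,θ}` on the critical line. -/
theorem exists_phase (hd : IsDominatingShift h) :
    ∃ φ ρ : ℝ → ℝ, (∀ t, ∃ φ', 0 < φ' ∧ HasDerivAt φ φ' t) ∧ (∃ c, ∀ t, φ t + φ (-t) = c) ∧
      (∀ t, ∃ ρ', HasDerivAt ρ ρ' t) ∧ (∀ t, 0 < ρ t) ∧
      ∀ θ t : ℝ, Arot h θ (1 / 2 + I * t) = ((ρ t * Real.cos (φ t + θ) : ℝ) : ℂ) := by
  obtain ⟨W, hW, hexp⟩ := hd.exists_log_line
  have hre (t : ℝ) : (1 / 2 + I * t : ℂ).re = 1 / 2 := by simp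
  have him (t : ℝ) : HasDerivAt (fun t ↦ (W t).im)
      (deriv xi (1 / 2 + I * t + h) / xi (1 / 2 + I * t + h)).re t := by
    rw [← I_mul_im]
    exact Complex.imCLM.hasFDerivAt.comp_hasDerivAt t (hW t)
  refine ⟨fun t ↦ (W t).im, fun t ↦ Real.exp (W t).re,
    fun t ↦ ⟨_, hd.re_logDeriv_pos (hre t), him t⟩, ?_, fun t ↦ ?_, fun t ↦ Real.exp_pos _, ?_⟩
  -- Conjugation symmetry makes `φ'` even, so `φ(t) + φ(-t)` has derivative zero.
  · refine ⟨(W 0).im + (W (-0)).im, fun t ↦ ?_⟩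
    have hder (t : ℝ) : HasDerivAt (fun t ↦ (W t).im + (W (-t)).im) 0 t := by
      have h1 := (him t).add ((him (-t)).comp t (hasDerivAt_neg t))
      convert! h1 using 1
      have h2 : (1 / 2 + I * ((-t : ℝ) : ℂ) + h : ℂ) = (starRingEnd ℂ) (1 / 2 + I * t + h) := by
        simp [map_ofNat]
      rw [h2, deriv_xi_conj, xi_conj, ← map_div₀, conj_re]
      ring
    exact is_const_of_deriv_eq_zero (fun t ↦ (hder t).differentiableAt)
      (fun t ↦ (hder t).deriv) t 0
  · have h1 := (Complex.reCLM.hasFDerivAt.comp_hasDerivAt t (hW t)).exp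
    exact ⟨_, h1⟩
  · intro θ t
    have h1 : exp (θ * I) * xi (1 / 2 + I * t + h) = exp ((W t).re + ((W t).im + θ : ℝ) * I) := by
      rw [hexp, ← exp_add]
      congr 1
      conv_lhs => rw [← re_add_im (W t)]
      push_cast
      ring
    have h2 : exp (-(θ * I)) * xi (1 / 2 + I * t - h) =
        (starRingEnd ℂ) (exp (θ * I) * xi (1 / 2 + I * t + h)) := by
      rw [xi_sub_of_re_eq_half (hre t), map_mul, ← exp_conj]
      simp
    rw [Arot_eq, h2, h1, one_div, ← div_eq_inv_mul, ← re_eq_add_conj, exp_re]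
    simp

theorem Arot_eq_zero_iff_of_line {φ ρ : ℝ → ℝ} (hρ : ∀ t, 0 < ρ t) {θ : ℝ}
    (hA : ∀ t : ℝ, Arot h θ (1 / 2 + I * t) = ((ρ t * Real.cos (φ t + θ) : ℝ) : ℂ)) (t : ℝ) :
    Arot h θ (1 / 2 + I * t) = 0 ↔ Real.cos (φ t + θ) = 0 := by
  rw [hA, ofReal_eq_zero, mul_eq_zero, or_iff_right (hρ t).ne']

theorem eq_half_add_I_mul {s : ℂ} (hs : s.re = 1 / 2) : s = 1 / 2 + I * s.im := by
  apply Complex.ext <;> simp [hs]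

/-- Where `cos(φ + θ)` vanishes, `ρ cos(φ + θ)` has derivative `-ρ φ' sin(φ + θ)`, and no factor is
zero. -/
theorem deriv_Arot_ne_zero (hd : IsDominatingShift h) {θ : ℝ} {s : ℂ} (hs : Arot h θ s = 0) :
    deriv (Arot h θ) s ≠ 0 := by
  obtain ⟨φ, ρ, hφ, -, hρ', hρ, hA⟩ := hd.exists_phase
  obtain ⟨t, rfl⟩ : ∃ t : ℝ, s = 1 / 2 + I * t :=
    ⟨s.im, eq_half_add_I_mul (hd.re_eq_half_of_Arot_eq_zero hs)⟩
  obtain ⟨φ', hφ', hφt⟩ := hφ t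
  obtain ⟨ρ', hρt⟩ := hρ' t
  have hcos := (Arot_eq_zero_iff_of_line hρ (hA θ) t).mp hs
  have h1 : HasDerivAt (fun t : ℝ ↦ (1 / 2 + I * t : ℂ)) I t := by
    simpa using ((hasDerivAt_id t).ofReal_comp.const_mul I).const_add (1 / 2)
  have h2 : HasDerivAt (fun t : ℝ ↦ Arot h θ (1 / 2 + I * t))
      (deriv (Arot h θ) (1 / 2 + I * t) * I) t :=
    (differentiable_Arot h θ _).hasDerivAt.comp t h1
  have h3 := (hρt.mul (hφt.add_const θ).cos).ofReal_comp
  have h4 := h2.unique (h3.congr_of_eventuallyEq (Filter.Eventually.of_forall (hA θ)))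
  intro h0
  rw [h0, zero_mul, hcos, mul_zero, zero_add, eq_comm, ofReal_eq_zero] at h4
  have hsin : Real.sin (φ t + θ) ≠ 0 := fun h5 ↦ by
    have := Real.sin_sq_add_cos_sq (φ t + θ)
    rw [h5, hcos] at this
    norm_num at this
  have := (hρ t).ne'
  have := hφ'.ne'
  simp_all

/-- Finitely many zeros at `θ = 0` and `θ = π/2` would make `A_h` and `B_h` of exponential type,
hence also `ξ(s + h) = A_h - i B_h`. -/
theorem not_finite_zeros (hd : IsDominatingShift h) (Z : ℝ → Finset ℂ) :
    ¬ ∀ θ s, Arot h θ s = 0 → s ∈ Z θ := by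
  intro hZ
  have key (θ : ℝ) := (orderBound_Arot h θ).exists_norm_le_exp (differentiable_Arot h θ) (Z θ)
    fun z hz ↦ ⟨hZ θ z hz, hd.deriv_Arot_ne_zero hz⟩
  obtain ⟨D₁, hD₁, h₁⟩ := key 0
  obtain ⟨D₂, hD₂, h₂⟩ := key (0 + Real.pi / 2)
  obtain ⟨x, hx⟩ := exists_exp_lt_norm_xi (1 + (D₁ + D₂) * (1 + |h|))
  have h3 := Arot_sub_Brot h 0 (x - h)
  rw [Brot_eq_Arot, ofReal_zero, mul_zero, exp_zero, one_mul, sub_add_cancel] at h3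
  have h4 : ‖(x - h : ℂ)‖ ≤ |x| + |h| := by
    refine (norm_sub_le _ _).trans ?_
    simp
  have h5 : 1 + ‖(x - h : ℂ)‖ ≤ (1 + |h|) * (1 + |x|) := by
    nlinarith [abs_nonneg x, abs_nonneg h]
  have h6 (D : ℝ) (hD : 0 ≤ D) (hD' : D ≤ D₁ + D₂) : Real.exp (D * (1 + ‖(x - h : ℂ)‖)) ≤
      Real.exp ((D₁ + D₂) * ((1 + |h|) * (1 + |x|))) := by gcongr
  have h7 : ‖xi x‖ ≤ 2 * Real.exp ((D₁ + D₂) * ((1 + |h|) * (1 + |x|))) := by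
    rw [← h3]
    refine (norm_sub_le _ _).trans ?_
    rw [norm_mul, norm_I, one_mul]
    linarith [h₁ (x - h), h₂ (x - h), h6 D₁ hD₁ (by linarith), h6 D₂ hD₂ (by linarith)]
  have h8 : 2 ≤ Real.exp (1 + |x|) := by
    linarith [Real.add_one_le_exp (1 + |x|), abs_nonneg x]
  rw [add_mul, Real.exp_add, one_mul, mul_assoc] at hx
  have h9 := Real.exp_pos ((D₁ + D₂) * ((1 + |h|) * (1 + |x|)))
  nlinarith

theorem not_bounded_phase (hd : IsDominatingShift h) {φ ρ : ℝ → ℝ} (hφ : Function.Injective φ)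
    (hρ : ∀ t, 0 < ρ t)
    (hA : ∀ θ t : ℝ, Arot h θ (1 / 2 + I * t) = ((ρ t * Real.cos (φ t + θ) : ℝ) : ℂ)) (M : ℝ) :
    ¬ ∀ t, |φ t| ≤ M := by
  intro hM
  have hfin (θ : ℝ) : {s : ℂ | Arot h θ s = 0}.Finite := by
    obtain ⟨N, hN⟩ := exists_nat_ge (M + |θ|)
    have h1 : ((fun k : ℤ ↦ (2 * k + 1) * Real.pi / 2 - θ) '' Icc (-N : ℤ) N).Finite :=
      (finite_Icc _ _).image _
    refine ((h1.preimage hφ.injOn).image fun t : ℝ ↦ (1 / 2 + I * t : ℂ)).subset fun s hs ↦ ?_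
    have hs' : Arot h θ s = 0 := hs
    have e := eq_half_add_I_mul (hd.re_eq_half_of_Arot_eq_zero hs')
    refine ⟨s.im, ?_, e.symm⟩
    rw [e, Arot_eq_zero_iff_of_line hρ (hA θ), Real.cos_eq_zero_iff] at hs'
    obtain ⟨k, hk⟩ := hs'
    refine ⟨k, ?_, by simp only; linarith⟩
    have h2 : |(2 * k + 1) * Real.pi / 2| ≤ N := by
      rw [← hk]
      exact (abs_add_le _ _).trans (by linarith [hM s.im])
    rw [abs_le] at h2
    have hπ := Real.pi_gt_three
    constructor
    · by_contra! hlt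
      have h3 : (k : ℝ) + 1 ≤ -N := by exact_mod_cast hlt
      nlinarith
    · by_contra! hlt
      have h3 : (N : ℝ) + 1 ≤ k := by exact_mod_cast hlt
      nlinarith
  exact hd.not_finite_zeros (fun θ ↦ (hfin θ).toFinset) fun θ s hs ↦ by simpa using hs

theorem exists_orderIso (hd : IsDominatingShift h) :
    ∃ φ : ℝ ≃o ℝ, ∀ θ t : ℝ, Arot h θ (1 / 2 + I * t) = 0 ↔ Real.cos (φ t + θ) = 0 := by
  obtain ⟨φ, ρ, hφ, ⟨c, hc⟩, -, hρ, hA⟩ := hd.exists_phase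
  have hmono : StrictMono φ := by
    refine strictMono_of_deriv_pos fun t ↦ ?_
    obtain ⟨φ', h1, h2⟩ := hφ t
    rwa [h2.deriv]
  have hcont : Continuous φ := continuous_iff_continuousAt.mpr fun t ↦
    (hφ t).choose_spec.2.continuousAt
  -- As `φ(t) + φ(-t) = c`, an upper bound for `φ` is also a lower one, contradicting unboundedness.
  have hunb (b : ℝ) : ∃ t, b ≤ φ t := by
    by_contra! hlt
    refine hd.not_bounded_phase hmono.injective hρ hA (|b| + |c|) fun t ↦ ?_
    have h1 := hc t
    have h2 := hlt t
    have h3 := hlt (-t)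
    rw [abs_le]
    constructor
    · linarith [le_abs_self b, neg_abs_le c]
    · linarith [le_abs_self b, abs_nonneg c]
  have htop : Filter.Tendsto φ Filter.atTop Filter.atTop :=
    Filter.tendsto_atTop_atTop_of_monotone hmono.monotone hunb
  have hbot : Filter.Tendsto φ Filter.atBot Filter.atBot := by
    refine Filter.tendsto_atBot_atBot_of_monotone hmono.monotone fun b ↦ ?_
    obtain ⟨t, ht⟩ := hunb (c - b)
    exact ⟨-t, by linarith [hc t]⟩
  exact ⟨hmono.orderIsoOfSurjective φ (hcont.surjective htop hbot), fun θ t ↦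
    Arot_eq_zero_iff_of_line hρ (hA θ) t⟩

theorem zerosSimple_Arot (hd : IsDominatingShift h) (θ : ℝ) : ZerosSimple (Arot h θ) :=
  fun s hs ↦ ((differentiable_Arot h θ).analyticAt s).analyticOrderAt_eq_one_of_zero_deriv_ne_zero
    hs (hd.deriv_Arot_ne_zero hs)

end IsDominatingShift

/-! ### Numbering and interlacing of the zeros -/

theorem isZeroNumbering_of_strictMono {f : ℂ → ℂ} (hf : Differentiable ℂ f) (hs : ZerosSimple f)
    {γ : ℤ → ℝ} (hγ : StrictMono γ)
    (hz : ∀ s, f s = 0 ↔ ∃ n, (1 / 2 : ℂ) + I * (γ n : ℂ) = s) : IsZeroNumbering f γ := by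
  refine ⟨hγ.monotone, fun s ↦ ?_⟩
  by_cases h0 : f s = 0
  · obtain ⟨n, hn⟩ := (hz s).mp h0
    rw [hs s h0, encard_eq_one]
    refine ⟨n, ?_⟩
    ext m
    simp only [mem_ofPred_eq, mem_singleton_iff]
    constructor
    · intro hm
      rw [← hn] at hm
      exact hγ.injective (by simpa using hm)
    · rintro rfl
      exact hn
  · rw [(hf.analyticAt s).analyticOrderAt_eq_zero.mpr h0, encard_eq_zero, eq_empty_iff_forall_notMem]
    exact fun n hn ↦ h0 ((hz s).mpr ⟨n, hn⟩)

theorem IsDominatingShift.isZeroNumbering {h : ℝ} (hd : IsDominatingShift h) {φ : ℝ ≃o ℝ}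
    (hφ : ∀ θ t : ℝ, Arot h θ (1 / 2 + I * t) = 0 ↔ Real.cos (φ t + θ) = 0) {θ c : ℝ}
    (hc : Real.cos (c + θ) = 0) :
    IsZeroNumbering (Arot h θ) fun n ↦ φ.symm (n * Real.pi + c) := by
  refine isZeroNumbering_of_strictMono (differentiable_Arot h θ) (hd.zerosSimple_Arot θ) ?_ ?_
  · intro m n hmn
    apply φ.symm.strictMono
    have : (m : ℝ) < n := by exact_mod_cast hmn
    have := mul_lt_mul_of_pos_right this Real.pi_pos
    linarith
  · intro s
    constructor
    · intro hs
      have e := eq_half_add_I_mul (hd.re_eq_half_of_Arot_eq_zero hs)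
      rw [e, hφ, Real.cos_eq_zero_iff] at hs
      obtain ⟨k, hk⟩ := hs
      obtain ⟨l, hl⟩ := Real.cos_eq_zero_iff.mp hc
      refine ⟨k - l, ?_⟩
      rw [e]
      congr 3
      rw [OrderIso.symm_apply_eq]
      push_cast
      linarith
    · rintro ⟨n, rfl⟩
      rw [hφ, OrderIso.apply_symm_apply, add_assoc, add_comm, Real.cos_add_int_mul_pi, hc, mul_zero]

theorem IsDominatingShift.zerosInterlace {h : ℝ} (hd : IsDominatingShift h) (θ θ' : ℝ)
    (hθ : Real.cos (θ' - θ) = 0) : ZerosInterlace (Arot h θ) (Arot h θ') := by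
  obtain ⟨φ, hφ⟩ := hd.exists_orderIso
  -- In the phase variable the zeros sit at `(n - 1/2)π - θ` and `nπ - θ`. The zeros of cosine have
  -- period `π`, so `θ' = θ + π/2` and `θ' = θ - π/2` are both covered; the latter arises for
  -- negative `h`.
  refine ⟨_, _, hd.isZeroNumbering hφ (c := -Real.pi / 2 - θ) ?_,
    hd.isZeroNumbering hφ (c := -θ) ?_, fun n ↦ ⟨?_, ?_⟩⟩
  · rw [sub_add_cancel, neg_div, Real.cos_neg, Real.cos_pi_div_two]
  · rwa [neg_add_eq_sub]
  · apply φ.symm.monotone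
    linarith [Real.pi_pos]
  · apply φ.symm.monotone
    push_cast
    linarith [Real.pi_pos]

theorem zeros_Arot_Brot_of_isDominatingShift {h : ℝ} (hd : IsDominatingShift |h|) (θ : ℝ) :
    (ZerosOnCriticalLine (Arot h θ) ∧ ZerosOnCriticalLine (Brot h θ)) ∧
      (ZerosSimple (Arot h θ) ∧ ZerosSimple (Brot h θ)) ∧
      ZerosInterlace (Arot h θ) (Brot h θ) := by
  have key (a b : ℝ) (hab : Real.cos (b - a) = 0) :
      (ZerosOnCriticalLine (Arot |h| a) ∧ ZerosOnCriticalLine (Arot |h| b)) ∧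
      (ZerosSimple (Arot |h| a) ∧ ZerosSimple (Arot |h| b)) ∧
      ZerosInterlace (Arot |h| a) (Arot |h| b) :=
    ⟨⟨fun _ ↦ hd.re_eq_half_of_Arot_eq_zero, fun _ ↦ hd.re_eq_half_of_Arot_eq_zero⟩,
      ⟨hd.zerosSimple_Arot a, hd.zerosSimple_Arot b⟩, hd.zerosInterlace a b hab⟩
  rw [Brot_eq_Arot]
  rcases le_total 0 h with h0 | h0
  · rw [abs_of_nonneg h0] at key
    exact key _ _ (by simp)
  · rw [abs_of_nonpos h0] at key
    have e (a : ℝ) : Arot h a = Arot (-h) (-a) := by rw [Arot_neg, neg_neg]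
    rw [e, e]
    refine key _ _ ?_
    rw [← Real.cos_neg]
    simp

end XiShift

theorem theorem2p1 :
    (∀ h θ : ℝ, 1 / 2 ≤ |h| → 0 ≤ θ → θ < 2 * Real.pi →
      (XiShift.ZerosOnCriticalLine (XiShift.Arot h θ) ∧
        XiShift.ZerosOnCriticalLine (XiShift.Brot h θ)) ∧
      (XiShift.ZerosSimple (XiShift.Arot h θ) ∧ XiShift.ZerosSimple (XiShift.Brot h θ)) ∧
      XiShift.ZerosInterlace (XiShift.Arot h θ) (XiShift.Brot h θ)) ∧
    (RiemannHypothesis → ∀ h θ : ℝ, 0 < |h| → |h| < 1 / 2 → 0 ≤ θ → θ < 2 * Real.pi →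
      (XiShift.ZerosOnCriticalLine (XiShift.Arot h θ) ∧
        XiShift.ZerosOnCriticalLine (XiShift.Brot h θ)) ∧
      (XiShift.ZerosSimple (XiShift.Arot h θ) ∧ XiShift.ZerosSimple (XiShift.Brot h θ)) ∧
      XiShift.ZerosInterlace (XiShift.Arot h θ) (XiShift.Brot h θ)) :=
  ⟨fun _ θ hh _ _ ↦ XiShift.zeros_Arot_Brot_of_isDominatingShift
      (XiShift.isDominatingShift_of_half_le hh) θ,
    fun hRH _ θ hh _ _ _ ↦ XiShift.zeros_Arot_Brot_of_isDominatingShift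
      (XiShift.isDominatingShift_of_riemannHypothesis hRH hh) θ⟩
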